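/- Throughout, $a_n\ll b_n$ means $a_n/b_n\to 0$ as $n\to\infty$. For finite graphs, $v_H$ and $e(H)$ denote the numbers of vertices and edges of $H$; $N(H,G)$ is the number of labelled copies of $H$ in $G$, i.e. of injective maps $V(H)\to V(G)$ sending edges to edges; and for an edge $e$ of $G$, $N(H,G,e)$ is the number of labelled copies of $H$ in $G$ that contain $e$. $\mathbb G(n,p)$ is the Erdős–Rényi random graph on $n$ vertices with edge probability $p$. Let $H$ be a connected $\Delta$-regular graph with $\Delta\ge 2$. Given $\delta,\varepsilon,\bar C>0$ and $p=p_n\in(0,1)$, a subgraph $G$ of the complete graph $K_n$ is called a *core graph* if (C1) $N(H,G)\ge \delta(1-3\varepsilon)\,n^{v_H}p^{e(H)}$, (C2) $e(G)\le \bar C n^2p^\Delta\log(1/p)$, and (C3) $N(H,G,e)\ge \delta\varepsilon\, n^{v_H}p^{e(H)}/(\bar C n^2p^\Delta\log(1/p))$ for every edge $e$ of $G$. **Proposition.** There are a nonnegative function $f_H$ with $\lim_{\varepsilon\downarrow 0}f_H(\varepsilon)=0$ and a number $\varepsilon_0>0$, both depending only on $H$, such that the following holds for every $\delta>0$, every $\varepsilon\in(0,\varepsilon_0)$,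 every constant $\bar C>0$ and every constant $\bar C_\star\ge 32\,\delta^{2/v_H}$. If $p=p_n\in(0,1)$ satisfies $$(\log n)^{1/(v_H-2)}\ll np^{\Delta/2}\quad\text{and}\quad np^{\Delta/2}\le n^{1/2}\ \text{ for all large } n,$$ then $$\liminf_{n\to\infty}\;\frac{-\log \mathbb P\big(\mathbb G(n,p)\text{ contains a core graph } G \text{ with } e(G)\ge \bar C_\star n^2p^\Delta\big)}{n^2p^\Delta\log(1/p)}\;\ge\;\frac12\,\delta^{2/v_H}\,\big(1-f_H(\varepsilon)\big),$$ where $-\log 0=+\infty$. -/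

import Mathlib

open Filter Topology Asymptotics MeasureTheory

/-- `N(H, G, e)`: the number of labelled copies of `H` in `G` (injective homomorphisms `H → G`)
that use the edge `e`. -/
noncomputable def labelledCopiesThrough {V W : Type*} (H : SimpleGraph V) (G : SimpleGraph W)
    (e : Sym2 W) : ℕ :=
  Nat.card {φ : H.Copy G // ∃ e' ∈ H.edgeSet, Sym2.map φ e' = e}

/-- The core graphs in the complete graph on `n` vertices, with parameters `δ`, `ε`, `Cbar`, for a
`Δ`-regular graph `H` and edge probability `p`. A subgraph of the complete graph is represented
by the graph on all `n` vertices with the same edges. -/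
structure IsCoreGraph {V : Type*} [Fintype V] (H : SimpleGraph V) (Δ : ℕ) (δ ε Cbar p : ℝ) {n : ℕ}
    (G : SimpleGraph (Fin n)) : Prop where
  /-- `G` has many labelled copies of `H`. -/
  copies_le : δ * (1 - 3 * ε) * ((n : ℝ) ^ Fintype.card V * p ^ H.edgeSet.ncard) ≤
    (G.labelledCopyCount H : ℝ)
  /-- `G` does not have too many edges. -/
  edges_le : (G.edgeSet.ncard : ℝ) ≤ Cbar * (n : ℝ) ^ 2 * p ^ Δ * Real.log (1 / p)
  /-- Every edge of `G` lies in many labelled copies of `H`. -/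
  through_le : ∀ e ∈ G.edgeSet,
    δ * ε * ((n : ℝ) ^ Fintype.card V * p ^ H.edgeSet.ncard) /
        (Cbar * (n : ℝ) ^ 2 * p ^ Δ * Real.log (1 / p)) ≤
      (labelledCopiesThrough H G e : ℝ)

/-- The event (a set of graphs `ω` on `n` vertices) that `ω` contains a core graph with at least
`Cstar * n ^ 2 * p ^ Δ` edges. -/
def largeCoreEvent {V : Type*} [Fintype V] (H : SimpleGraph V) (Δ : ℕ) (δ ε Cbar Cstar p : ℝ)
    (n : ℕ) : Set (SimpleGraph (Fin n)) :=
  {ω | ∃ G : SimpleGraph (Fin n), G ≤ ω ∧ IsCoreGraph H Δ δ ε Cbar p G ∧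
    Cstar * (n : ℝ) ^ 2 * p ^ Δ ≤ (G.edgeSet.ncard : ℝ)}

/-! Put s = n p^(Δ/2), L = log(1/p), v = v_H, and let X be the sum of (deg x - Δ)^+ over the
vertices of a core graph G (`degreeExcess`). Non-isolated vertices of G have degree at least Δ, so
2e(G) = X + Δk, where k is their number, and p^e(G) = p^(X/2) (s/n)^k. The choice of the k vertices
costs at most n^k, so Δ edges at each vertex are nearly free and only X has to be paid for. A union
bound over the core graphs then needs two inputs.

Lower bound on X. If G has O(s^2) edges, then N(H,G) ≤ ((1+ζ)X)^(v/2) + ζ s^v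
(`card_copyMaps_le_rpow_degreeExcess`). To see this, fix degree thresholds K and K', far apart and
with few edges at the vertices in between. By Shearer's inequality, all copies are negligible except
those with all vertices high and those whose low vertices form one side of a bipartition of H. The
former number at most (ordered high-high adjacent pairs)^(v/2); the latter are controlled by weights
of the low vertices. The pairs and the weights together amount to at most (1+ζ)X. With (C1) this
gives X ≥ (1-O(ε)) δ^(2/v) s^2. If G has more edges, X ≥ const·e(G) suffices
(`sum_degree_le_mul_degreeExcess`). Both cases leave room for an extra term η·Σ deg
(`exists_core_bounds`).

Entropy. By (C3) and Shearer, the degrees of adjacent vertices have product at least s^2 up to a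
power of L (`exists_degree_product_ge`). Hence the neighbours of x lie in a set of at most B·deg x
vertices, with B a power of L up to a constant, and at most ∏ (eB)^(d_x) graphs have degrees d_x
(`card_graphs_le`). The factors p^(η d_x/2) beat (eB)^(d_x), and summing over degree sequences costs
only (1+s/n)^n ≤ e^s, which is negligible against exp(s^2 L) (`sum_pow_card_edgeFinset_le`). -/

/-! ### Hölder and Shearer inequalities -/

/-- Hölder's inequality for `k` functions, in terms of `k`-th powers. -/
theorem sum_pow_le_mul_prod_sum {ι J : Type*} (s : Finset ι) (T : Finset J) {k : ℕ} (hk : 0 < k)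
    (hT : T.card = k) (g : ι → ℝ) (f : J → ι → ℝ) (C : ℝ) (hC : 0 ≤ C) (hg : ∀ w ∈ s, 0 ≤ g w)
    (hf : ∀ j ∈ T, ∀ w ∈ s, 0 ≤ f j w) (h : ∀ w ∈ s, g w ^ k ≤ C * ∏ j ∈ T, f j w) :
    (∑ w ∈ s, g w) ^ k ≤ C * ∏ j ∈ T, ∑ w ∈ s, f j w := by
  have hk' : (k : ℝ) ≠ 0 := by positivity
  have hA : ∀ j ∈ T, 0 ≤ ∑ w ∈ s, f j w := fun j hj ↦ Finset.sum_nonneg (hf j hj)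
  by_cases h0 : ∃ j ∈ T, ∑ w ∈ s, f j w = 0
  · obtain ⟨j, hj, h0⟩ := h0
    rw [Finset.sum_eq_zero_iff_of_nonneg (hf j hj)] at h0
    have : ∑ w ∈ s, g w = 0 := by
      refine Finset.sum_eq_zero fun w hw ↦ ?_
      have h1 := h w hw
      rw [Finset.prod_eq_zero hj (h0 w hw), mul_zero] at h1
      exact pow_eq_zero_iff hk.ne' |>.1 (le_antisymm h1 (pow_nonneg (hg w hw) k))
    rw [this, zero_pow hk.ne']
    exact mul_nonneg hC (Finset.prod_nonneg hA)
  · push Not at h0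
    have hpos : ∀ j ∈ T, 0 < ∑ w ∈ s, f j w := fun j hj ↦ lt_of_le_of_ne (hA j hj) (h0 j hj).symm
    set P := ∏ j ∈ T, ∑ w ∈ s, f j w with hP
    have hPpos : 0 < P := Finset.prod_pos hpos
    -- AM-GM for the functions f j normalised to total mass 1; summing over w then gives total
    -- weight 1.
    have key : ∀ w ∈ s, g w ≤
        (C * P) ^ (1 / (k : ℝ)) * ∑ j ∈ T, (1 / (k : ℝ)) * (f j w / ∑ w ∈ s, f j w) := by
      intro w hw
      have h1 : ∏ j ∈ T, (f j w / ∑ w ∈ s, f j w) ^ (1 / (k : ℝ)) ≤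
          ∑ j ∈ T, (1 / (k : ℝ)) * (f j w / ∑ w ∈ s, f j w) := by
        refine Real.geom_mean_le_arith_mean_weighted T (fun _ ↦ 1 / (k : ℝ)) _
          (fun _ _ ↦ by positivity) ?_ (fun j hj ↦ div_nonneg (hf j hj w hw) (hA j hj))
        rw [Finset.sum_const, hT, nsmul_eq_mul]
        field_simp
      rw [Real.finsetProd_rpow _ _ (fun j hj ↦ div_nonneg (hf j hj w hw) (hA j hj)),
        Finset.prod_div_distrib] at h1
      have h2 : g w = (g w ^ k) ^ (1 / (k : ℝ)) := by
        rw [one_div, Real.pow_rpow_inv_natCast (hg w hw) hk.ne']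
      have h3 : 0 ≤ ∏ j ∈ T, f j w := Finset.prod_nonneg fun j hj ↦ hf j hj w hw
      calc g w = (g w ^ k) ^ (1 / (k : ℝ)) := h2
        _ ≤ (C * ∏ j ∈ T, f j w) ^ (1 / (k : ℝ)) :=
          Real.rpow_le_rpow (pow_nonneg (hg w hw) k) (h w hw) (by positivity)
        _ = (C * P) ^ (1 / (k : ℝ)) * ((∏ j ∈ T, f j w) / P) ^ (1 / (k : ℝ)) := by
          rw [← Real.mul_rpow (by positivity) (by positivity)]
          congr 1
          field_simp
        _ ≤ _ := mul_le_mul_of_nonneg_left h1 (by positivity)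
    have h4 : ∑ w ∈ s, g w ≤ (C * P) ^ (1 / (k : ℝ)) := by
      refine (Finset.sum_le_sum key).trans ?_
      rw [← Finset.mul_sum, Finset.sum_comm]
      have : ∑ j ∈ T, ∑ w ∈ s, (1 / (k : ℝ)) * (f j w / ∑ w ∈ s, f j w) = 1 := by
        have : ∀ j ∈ T, ∑ w ∈ s, (1 / (k : ℝ)) * (f j w / ∑ w ∈ s, f j w) = 1 / k := by
          intro j hj
          rw [← Finset.mul_sum, ← Finset.sum_div, div_self (hpos j hj).ne', mul_one]
        rw [Finset.sum_congr rfl this, Finset.sum_const, hT, nsmul_eq_mul]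
        field_simp
      rw [this, mul_one]
    calc (∑ w ∈ s, g w) ^ k ≤ ((C * P) ^ (1 / (k : ℝ))) ^ k :=
          pow_le_pow_left₀ (Finset.sum_nonneg hg) h4 k
      _ = C * P := by
        rw [one_div, Real.rpow_inv_natCast_pow (by positivity) hk.ne']

set_option maxHeartbeats 1000000 in
open Classical in
/-- **Shearer's inequality** for finite families of functions. -/
theorem card_pow_le_prod_card_image_restrict {V W J : Type*} (U : Finset V)
    (T : Finset J) (S : J → Finset V) {k : ℕ} (hk : 0 < k)
    (hcov : ∀ v ∈ U, (T.filter fun j ↦ v ∈ S j).card = k) :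
    ∀ (F : Finset (V → W)) (ψ : V → W), (∀ φ ∈ F, ∀ v ∉ U, φ v = ψ v) →
      F.card ^ k ≤ ∏ j ∈ T, (F.image (S j).restrict).card := by
  induction U using Finset.induction_on with
  | empty =>
    intro F ψ hF
    have hc : F.card ≤ 1 := by
      rw [Finset.card_le_one]
      intro a ha b hb
      funext v
      rw [hF a ha v (by simp), hF b hb v (by simp)]
    rcases Nat.le_one_iff_eq_zero_or_eq_one.1 hc with h | h
    · simp [h, hk.ne']
    · rw [h, one_pow]
      refine Finset.one_le_prod' fun j _ ↦ ?_
      rw [Nat.one_le_iff_ne_zero, Finset.card_ne_zero]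
      exact (Finset.card_pos.1 (by omega)).image _
  | insert v U hv ih =>
    intro F ψ hF
    have ih' := ih (fun u hu ↦ hcov u (Finset.mem_insert_of_mem hu))
    -- Split F by the value w at v and apply induction to each part. Sets S j missing v get the
    -- bound A j, uniform in w; the k sets containing v are summed over w by Hölder.
    set Fw : W → Finset (V → W) := fun w ↦ F.filter fun φ ↦ φ v = w with hFw
    have h1 : ∀ w, (Fw w).card ^ k ≤ ∏ j ∈ T, ((Fw w).image (S j).restrict).card := by
      intro w
      refine ih' (Fw w) (Function.update ψ v w) ?_
      intro φ hφ u hu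
      rw [hFw, Finset.mem_filter] at hφ
      by_cases huv : u = v
      · subst huv
        rw [Function.update_self]
        exact hφ.2
      · rw [Function.update_of_ne huv]
        exact hF φ hφ.1 u fun h ↦ (Finset.mem_insert.1 h).elim huv hu
    set s := F.image fun φ ↦ φ v with hs
    have hsum : F.card = ∑ w ∈ s, (Fw w).card :=
      Finset.card_eq_sum_card_fiberwise (fun φ hφ ↦ Finset.mem_image_of_mem _ hφ)
    set A : J → ℕ := fun j ↦ (F.image (S j).restrict).card with hA
    have hmono : ∀ w j, ((Fw w).image (S j).restrict).card ≤ A j := fun w j ↦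
      Finset.card_le_card (Finset.image_subset_image (Finset.filter_subset _ _))
    have hH := sum_pow_le_mul_prod_sum s (T.filter fun j ↦ v ∈ S j) hk
      (hcov v (Finset.mem_insert_self _ _)) (fun w ↦ ((Fw w).card : ℝ))
      (fun j w ↦ (((Fw w).image (S j).restrict).card : ℝ))
      (∏ j ∈ T.filter (fun j ↦ v ∉ S j), (A j : ℝ)) (Finset.prod_nonneg fun _ _ ↦ Nat.cast_nonneg _)
      (fun _ _ ↦ Nat.cast_nonneg _) (fun _ _ _ _ ↦ Nat.cast_nonneg _) (by
        intro w _
        have := h1 w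
        rw [← Finset.prod_filter_not_mul_prod_filter T (fun j ↦ v ∈ S j)] at this
        have h2 : ((Fw w).card : ℝ) ^ k ≤
            (∏ j ∈ T.filter (fun j ↦ v ∉ S j), (((Fw w).image (S j).restrict).card : ℝ)) *
            ∏ j ∈ T.filter (fun j ↦ v ∈ S j), (((Fw w).image (S j).restrict).card : ℝ) := by
          exact_mod_cast this
        refine h2.trans (mul_le_mul_of_nonneg_right ?_
          (Finset.prod_nonneg fun _ _ ↦ Nat.cast_nonneg _))
        exact Finset.prod_le_prod (fun _ _ ↦ Nat.cast_nonneg _)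
          fun j _ ↦ by exact_mod_cast hmono w j)
    -- A restriction to S j that contains v remembers w, so the images of different parts are
    -- disjoint.
    have hle : ∀ j ∈ T.filter (fun j ↦ v ∈ S j),
        ∑ w ∈ s, ((Fw w).image (S j).restrict).card ≤ A j := by
      intro j hj
      have hvj : v ∈ S j := (Finset.mem_filter.1 hj).2
      rw [← Finset.card_biUnion]
      · refine Finset.card_le_card ?_
        intro x hx
        obtain ⟨w, _, hx⟩ := Finset.mem_biUnion.1 hx
        exact Finset.image_subset_image (Finset.filter_subset _ _) hx
      · intro w _ w' _ hne
        rw [Function.onFun, Finset.disjoint_left]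
        intro x hx hx'
        obtain ⟨φ, hφ, rfl⟩ := Finset.mem_image.1 hx
        obtain ⟨φ', hφ', h⟩ := Finset.mem_image.1 hx'
        have := congrFun h ⟨v, hvj⟩
        simp only [Finset.restrict] at this
        rw [hFw, Finset.mem_filter] at hφ hφ'
        exact hne (by rw [← hφ.2, ← hφ'.2, this])
    have hfin : ((F.card : ℝ)) ^ k ≤ ∏ j ∈ T, (A j : ℝ) := by
      rw [hsum, Nat.cast_sum, ← Finset.prod_filter_not_mul_prod_filter T (fun j ↦ v ∈ S j)]
      refine hH.trans (mul_le_mul_of_nonneg_left ?_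
        (Finset.prod_nonneg fun _ _ ↦ Nat.cast_nonneg _))
      refine Finset.prod_le_prod (fun _ _ ↦ Finset.sum_nonneg fun _ _ ↦ Nat.cast_nonneg _) fun j hj ↦ ?_
      exact_mod_cast hle j hj
    exact_mod_cast hfin

/-! ### Labelled copies as maps, and Shearer along the edges of H -/

section CopyMaps

variable {V W : Type*} [Fintype V] [Fintype W]

open Classical in
/-- The injective maps `V → W` that send edges of `H` to edges of `G`. -/
noncomputable def copyMaps (H : SimpleGraph V) (G : SimpleGraph W) : Finset (V → W) :=
  Finset.univ.filter fun φ ↦ Function.Injective φ ∧ ∀ a b, H.Adj a b → G.Adj (φ a) (φ b)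

theorem mem_copyMaps {H : SimpleGraph V} {G : SimpleGraph W} {φ : V → W} :
    φ ∈ copyMaps H G ↔ Function.Injective φ ∧ ∀ a b, H.Adj a b → G.Adj (φ a) (φ b) := by
  simp [copyMaps]

/-- Labelled copies as injective edge-preserving maps. -/
noncomputable def copyEquivCopyMaps (H : SimpleGraph V) (G : SimpleGraph W) :
    H.Copy G ≃ {φ : V → W // φ ∈ copyMaps H G} where
  toFun f := ⟨f, mem_copyMaps.2 ⟨f.injective', fun _ _ h ↦ f.toHom.map_adj h⟩⟩
  invFun φ := ⟨⟨φ.1, fun {a b} h ↦ (mem_copyMaps.1 φ.2).2 a b h⟩, (mem_copyMaps.1 φ.2).1⟩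
  left_inv _ := rfl
  right_inv _ := rfl

theorem labelledCopyCount_eq_card_copyMaps (H : SimpleGraph V) (G : SimpleGraph W) :
    G.labelledCopyCount H = (copyMaps H G).card := by
  classical
  rw [SimpleGraph.labelledCopyCount, ← Fintype.card_coe]
  exact Fintype.card_congr (copyEquivCopyMaps H G)

open Classical in
theorem labelledCopiesThrough_eq_card (H : SimpleGraph V) (G : SimpleGraph W) (x y : W) :
    labelledCopiesThrough H G s(x, y) =
      ((copyMaps H G).filter fun φ ↦ ∃ a b, H.Adj a b ∧ φ a = x ∧ φ b = y).card := by
  have key : ∀ φ : H.Copy G, (∃ e' ∈ H.edgeSet, Sym2.map φ e' = s(x, y)) ↔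
      (copyEquivCopyMaps H G φ).1 ∈
        (copyMaps H G).filter fun φ ↦ ∃ a b, H.Adj a b ∧ φ a = x ∧ φ b = y := by
    intro φ
    rw [Finset.mem_filter, and_iff_right (copyEquivCopyMaps H G φ).2]
    constructor
    · rintro ⟨e, he, h⟩
      induction e using Sym2.ind with
      | _ a b =>
        rw [Sym2.map_mk, Sym2.eq_iff] at h
        rcases h with h | h
        · exact ⟨a, b, he, h⟩
        · exact ⟨b, a, SimpleGraph.Adj.symm he, h.2, h.1⟩
    · rintro ⟨a, b, hab, h⟩
      refine ⟨s(a, b), hab, ?_⟩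
      rw [Sym2.map_mk, Sym2.eq_iff]
      exact Or.inl h
  rw [labelledCopiesThrough, ← Nat.card_eq_finsetCard]
  exact Nat.card_congr (((copyEquivCopyMaps H G).subtypeEquiv key).trans
    (Equiv.subtypeSubtypeEquivSubtype fun h ↦ (Finset.mem_filter.1 h).1))

open Classical in
/-- Ordered pairs of adjacent vertices. -/
noncomputable def adjPairs (G : SimpleGraph W) : Finset (W × W) :=
  Finset.univ.filter fun p ↦ G.Adj p.1 p.2

open Classical in
theorem card_adjPairs_filter_fst (G : SimpleGraph W) (P : W → Prop) :
    ((adjPairs G).filter fun p ↦ P p.1).card =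
      ∑ x ∈ Finset.univ.filter P, G.degree x := by
  rw [Finset.card_eq_sum_card_fiberwise (f := Prod.fst) (t := Finset.univ.filter P)]
  · refine Finset.sum_congr rfl fun x hx ↦ ?_
    rw [← SimpleGraph.card_neighborFinset_eq_degree]
    refine Finset.card_bij (fun p _ ↦ p.2) ?_ ?_ ?_
    · intro p hp
      simp only [adjPairs, Finset.mem_filter, Finset.mem_univ, true_and] at hp
      rw [SimpleGraph.mem_neighborFinset, ← hp.2]
      exact hp.1.1
    · intro p hp q hq h
      simp only [adjPairs, Finset.mem_filter, Finset.mem_univ, true_and] at hp hq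
      exact Prod.ext (hp.2.trans hq.2.symm) h
    · intro y hy
      rw [SimpleGraph.mem_neighborFinset] at hy
      simp only [Finset.mem_filter, Finset.mem_univ, true_and] at hx
      exact ⟨(x, y), by simp [adjPairs, hy, hx], rfl⟩
  · intro p hp
    simp only [Finset.coe_filter, Set.mem_ofPred_eq] at hp
    simpa using hp.2

open Classical in
theorem card_adjPairs (G : SimpleGraph W) : (adjPairs G).card = ∑ x, G.degree x := by
  have := card_adjPairs_filter_fst G (fun _ ↦ True)
  simpa using this

open Classical in
/-- Shearer's inequality for the edges of a regular graph. -/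
theorem card_pow_le_prod_edgeFinset {W : Type*} {H : SimpleGraph V} {Δ : ℕ} (hΔ : 0 < Δ)
    (hreg : H.IsRegularOfDegree Δ) (F : Finset (V → W)) (B : Sym2 V → ℕ)
    (hB : ∀ a b, H.Adj a b → (F.image fun φ ↦ (φ a, φ b)).card ≤ B s(a, b)) :
    F.card ^ Δ ≤ ∏ e ∈ H.edgeFinset, B e := by
  rcases F.eq_empty_or_nonempty with rfl | ⟨ψ, -⟩
  · simp [hΔ.ne']
  -- By regularity the edges cover every vertex exactly Δ times.
  refine (card_pow_le_prod_card_image_restrict Finset.univ H.edgeFinset (fun e ↦ e.toFinset) hΔ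
    ?_ F ψ (by simp)).trans ?_
  · intro v _
    rw [← hreg v, ← SimpleGraph.card_incidenceFinset_eq_degree, SimpleGraph.incidenceFinset_eq_filter]
    congr 1
    ext e
    simp
  · refine Finset.prod_le_prod' fun e he ↦ ?_
    induction e using Sym2.ind with
    | _ a b =>
      refine le_trans ?_ (hB a b (by simpa using he))
      refine Finset.card_le_card_of_surjOn
        (fun p v ↦ if v.1 = a then p.1 else p.2) ?_
      intro x hx
      obtain ⟨φ, hφ, rfl⟩ := Finset.mem_image.1 (Finset.mem_coe.1 hx)
      refine ⟨(φ a, φ b), by simpa using ⟨φ, hφ, rfl, rfl⟩, ?_⟩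
      funext ⟨v, hv⟩
      have hv' : v = a ∨ v = b := by simpa using hv
      by_cases hva : v = a
      · simp [hva]
      · obtain rfl := hv'.resolve_left hva
        simp [hva]

-- Confining a single edge of H to a small set R' replaces one of the e(H) Shearer factors; this is
-- how exceptional copies are shown to be few.
open Classical in
theorem card_pow_le_of_pair_mem {W : Type*} {H : SimpleGraph V} {Δ : ℕ} (hΔ : 0 < Δ)
    (hreg : H.IsRegularOfDegree Δ) (F : Finset (V → W)) (R R' : Finset (W × W))
    (hR : ∀ φ ∈ F, ∀ a b, H.Adj a b → (φ a, φ b) ∈ R) {a b : V} (hab : H.Adj a b)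
    (hR' : ∀ φ ∈ F, (φ a, φ b) ∈ R') :
    F.card ^ Δ ≤ R'.card * R.card ^ (H.edgeFinset.card - 1) := by
  have hR'' : ∀ φ ∈ F, (φ b, φ a) ∈ R'.image Prod.swap := fun φ hφ ↦
    Finset.mem_image.2 ⟨_, hR' φ hφ, rfl⟩
  have := card_pow_le_prod_edgeFinset hΔ hreg F (fun e ↦ if e = s(a, b) then R'.card else R.card) (by
    intro x y hxy
    split_ifs with h
    · rw [Sym2.eq_iff] at h
      rcases h with ⟨rfl, rfl⟩ | ⟨rfl, rfl⟩
      · refine Finset.card_le_card ?_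
        intro p hp
        obtain ⟨φ, hφ, rfl⟩ := Finset.mem_image.1 hp
        exact hR' φ hφ
      · refine le_trans (Finset.card_le_card (t := R'.image Prod.swap) ?_) Finset.card_image_le
        intro p hp
        obtain ⟨φ, hφ, rfl⟩ := Finset.mem_image.1 hp
        exact hR'' φ hφ
    · refine Finset.card_le_card ?_
      intro p hp
      obtain ⟨φ, hφ, rfl⟩ := Finset.mem_image.1 hp
      exact hR φ hφ x y hxy)
  refine this.trans_eq ?_
  have hmem : s(a, b) ∈ H.edgeFinset := by simpa using hab
  rw [← Finset.mul_prod_erase _ _ hmem, if_pos rfl, Finset.prod_congr rfl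
    (g := fun _ ↦ R.card) (fun e he ↦ if_neg (Finset.ne_of_mem_erase he)), Finset.prod_const,
    Finset.card_erase_of_mem hmem]

open Classical in
theorem card_pow_le_of_forall_pair_mem {W : Type*} {H : SimpleGraph V} {Δ : ℕ} (hΔ : 0 < Δ)
    (hreg : H.IsRegularOfDegree Δ) (F : Finset (V → W)) (R : Finset (W × W))
    (hR : ∀ φ ∈ F, ∀ a b, H.Adj a b → (φ a, φ b) ∈ R) :
    F.card ^ Δ ≤ R.card ^ H.edgeFinset.card := by
  refine (card_pow_le_prod_edgeFinset hΔ hreg F (fun _ ↦ R.card) ?_).trans_eq (Finset.prod_const _)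
  intro x y hxy
  refine Finset.card_le_card ?_
  intro p hp
  obtain ⟨φ, hφ, rfl⟩ := Finset.mem_image.1 hp
  exact hR φ hφ x y hxy

-- Once the edge ab is fixed, the other edges of H split into Δ-1 at a, Δ-1 at b, and those disjoint
-- from ab.
open Classical in
theorem card_edges_avoiding {H : SimpleGraph V} {Δ : ℕ} (hΔ : 0 < Δ)
    (hreg : H.IsRegularOfDegree Δ) {a b : V} (hab : H.Adj a b) :
    (H.edgeFinset.filter fun e ↦ a ∈ e ∧ e ≠ s(a, b)).card = Δ - 1 ∧
    (H.edgeFinset.filter fun e ↦ a ∉ e ∧ b ∉ e).card + (2 * Δ - 1) = H.edgeFinset.card := by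
  have hinc : ∀ v, (H.edgeFinset.filter fun e ↦ v ∈ e).card = Δ := by
    intro v
    rw [← hreg v, ← SimpleGraph.card_incidenceFinset_eq_degree,
      SimpleGraph.incidenceFinset_eq_filter]
  have hmem : s(a, b) ∈ H.edgeFinset := by simpa using hab
  have h1 : ∀ v, v ∈ s(a, b) →
      (H.edgeFinset.filter fun e ↦ v ∈ e ∧ e ≠ s(a, b)).card = Δ - 1 := by
    intro v hv
    rw [← hinc v, ← Finset.card_erase_of_mem (a := s(a, b)) (Finset.mem_filter.2 ⟨hmem, hv⟩)]
    congr 1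
    ext e
    simp only [Finset.mem_filter, Finset.mem_erase]
    tauto
  refine ⟨h1 a (by simp), ?_⟩
  have h2 := Finset.card_filter_add_card_filter_not (s := H.edgeFinset) (fun e ↦ a ∈ e)
  have h3 := Finset.card_filter_add_card_filter_not
    (s := H.edgeFinset.filter fun e ↦ a ∉ e) (fun e ↦ b ∈ e)
  rw [hinc] at h2
  rw [Finset.filter_filter, Finset.filter_filter] at h3
  have h4 : (H.edgeFinset.filter fun e ↦ a ∉ e ∧ b ∈ e) =
      H.edgeFinset.filter fun e ↦ b ∈ e ∧ e ≠ s(a, b) := by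
    refine Finset.filter_congr fun e _ ↦ ?_
    have : (a ∈ e ∧ b ∈ e) ↔ e = s(a, b) := Sym2.mem_and_mem_iff hab.ne
    tauto
  rw [h4, h1 b (by simp)] at h3
  omega

open Classical in
/-- Copies with a prescribed image of an edge are few when its degrees are small. -/
theorem card_copies_fixed_edge_pow_le {H : SimpleGraph V} {Δ : ℕ} (hΔ : 0 < Δ)
    (hreg : H.IsRegularOfDegree Δ) (G : SimpleGraph W) {a b : V} (hab : H.Adj a b) (x y : W) {r : ℕ}
    (hr : r + (2 * Δ - 1) = H.edgeFinset.card) :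
    ((copyMaps H G).filter fun φ ↦ φ a = x ∧ φ b = y).card ^ Δ ≤
      (G.degree x * G.degree y) ^ (Δ - 1) * (adjPairs G).card ^ r := by
  set F := (copyMaps H G).filter fun φ ↦ φ a = x ∧ φ b = y with hF
  have hFm : ∀ φ ∈ F, φ a = x ∧ φ b = y ∧ ∀ c d, H.Adj c d → G.Adj (φ c) (φ d) := by
    intro φ hφ
    rw [hF, Finset.mem_filter, mem_copyMaps] at hφ
    exact ⟨hφ.2.1, hφ.2.2, hφ.1.2⟩
  have hnb : ∀ c d z, H.Adj c d → (∀ φ ∈ F, φ c = z) →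
      (F.image fun φ ↦ (φ c, φ d)).card ≤ G.degree z ∧
      (F.image fun φ ↦ (φ d, φ c)).card ≤ G.degree z := by
    intro c d z hcd hz
    rw [← SimpleGraph.card_neighborFinset_eq_degree]
    constructor
    · refine (Finset.card_le_card (t := (G.neighborFinset z).image fun w ↦ (z, w)) ?_).trans
        Finset.card_image_le
      intro p hp
      obtain ⟨φ, hφ, rfl⟩ := Finset.mem_image.1 hp
      refine Finset.mem_image.2 ⟨φ d, ?_, by rw [hz φ hφ]⟩
      rw [SimpleGraph.mem_neighborFinset, ← hz φ hφ]
      exact (hFm φ hφ).2.2 c d hcd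
    · refine (Finset.card_le_card (t := (G.neighborFinset z).image fun w ↦ (w, z)) ?_).trans
        Finset.card_image_le
      intro p hp
      obtain ⟨φ, hφ, rfl⟩ := Finset.mem_image.1 hp
      refine Finset.mem_image.2 ⟨φ d, ?_, by rw [hz φ hφ]⟩
      rw [SimpleGraph.mem_neighborFinset, ← hz φ hφ]
      exact (hFm φ hφ).2.2 c d hcd
  -- The edge ab has one image, another edge at a at most deg x, another edge at b at most deg y,
  -- and a disjoint edge at most 2e(G).
  have key := card_pow_le_prod_edgeFinset hΔ hreg F
    (fun e ↦ (if a ∈ e ∧ e ≠ s(a, b) then G.degree x else 1) *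
      (if b ∈ e ∧ e ≠ s(b, a) then G.degree y else 1) *
      (if a ∉ e ∧ b ∉ e then (adjPairs G).card else 1)) (by
    have ha : ∀ φ ∈ F, φ a = x := fun φ hφ ↦ (hFm φ hφ).1
    have hb : ∀ φ ∈ F, φ b = y := fun φ hφ ↦ (hFm φ hφ).2.1
    have hne := hab.ne
    intro c d hcd
    have hcd' := hcd.ne
    by_cases he : s(c, d) = s(a, b)
    · have hone : (F.image fun φ ↦ (φ c, φ d)).card ≤ 1 := by
        rw [Finset.card_le_one]
        intro p hp q hq
        obtain ⟨φ, hφ, rfl⟩ := Finset.mem_image.1 hp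
        obtain ⟨φ', hφ', rfl⟩ := Finset.mem_image.1 hq
        rcases Sym2.eq_iff.1 he with ⟨rfl, rfl⟩ | ⟨rfl, rfl⟩ <;>
          rw [ha _ hφ, ha _ hφ', hb _ hφ, hb _ hφ']
      have he' : s(c, d) = s(b, a) := by rw [he, Sym2.eq_swap]
      refine hone.trans_eq ?_
      rw [if_neg (fun h ↦ h.2 he), if_neg (fun h ↦ h.2 he'), if_neg, mul_one, mul_one]
      rw [he]
      simp
    · have he' : s(c, d) ≠ s(b, a) := by rwa [Sym2.eq_swap (a := b)]
      by_cases hac : a ∈ s(c, d)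
      · have hbc : b ∉ s(c, d) := fun h ↦ he ((Sym2.mem_and_mem_iff hne).1 ⟨hac, h⟩)
        rw [if_pos ⟨hac, he⟩, if_neg (fun h ↦ hbc h.1), if_neg (fun h ↦ h.1 hac), mul_one, mul_one]
        rcases Sym2.mem_iff.1 hac with rfl | rfl
        · exact (hnb _ _ x hcd ha).1
        · exact (hnb _ _ x hcd.symm ha).2
      · by_cases hbc : b ∈ s(c, d)
        · rw [if_neg (fun h ↦ hac h.1), if_pos ⟨hbc, he'⟩, if_neg (fun h ↦ h.2 hbc), mul_one,
            one_mul]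
          rcases Sym2.mem_iff.1 hbc with rfl | rfl
          · exact (hnb _ _ y hcd hb).1
          · exact (hnb _ _ y hcd.symm hb).2
        · rw [if_neg (fun h ↦ hac h.1), if_neg (fun h ↦ hbc h.1), if_pos ⟨hac, hbc⟩, one_mul,
            one_mul]
          refine Finset.card_le_card ?_
          intro p hp
          obtain ⟨φ, hφ, rfl⟩ := Finset.mem_image.1 hp
          simpa [adjPairs] using (hFm φ hφ).2.2 c d hcd)
  refine key.trans_eq ?_
  obtain ⟨h1, h2⟩ := card_edges_avoiding hΔ hreg hab
  obtain ⟨h3, -⟩ := card_edges_avoiding hΔ hreg hab.symm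
  rw [Finset.prod_mul_distrib, Finset.prod_mul_distrib]
  simp only [Finset.prod_ite, Finset.prod_const_one, mul_one, Finset.prod_const]
  rw [h1, h3, mul_pow]
  congr 2
  omega

end CopyMaps

/-! ### The degree excess is a positive proportion of the degree sum -/

section Excess

variable {V W : Type*} [Fintype V] [Fintype W]

open Classical in
/-- The total excess of the degrees of `G` over `Δ`. -/
noncomputable def degreeExcess (G : SimpleGraph W) (Δ : ℕ) : ℕ := ∑ x, (G.degree x - Δ)

-- The identity 2e(G) = X + Δk behind the cost estimate in the union bound.
open Classical in
theorem degreeExcess_add_mul {G : SimpleGraph W} {Δ : ℕ}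
    (hmin : ∀ x, G.degree x ≠ 0 → Δ ≤ G.degree x) :
    degreeExcess G Δ + Δ * (Finset.univ.filter fun x ↦ G.degree x ≠ 0).card =
      ∑ x, G.degree x := by
  rw [degreeExcess, mul_comm, ← smul_eq_mul, ← Finset.sum_const, Finset.sum_filter,
    ← Finset.sum_add_distrib]
  refine Finset.sum_congr rfl fun x _ ↦ ?_
  split_ifs with h
  · have := hmin x h
    omega
  · simp only [not_not] at h
    omega

open Classical in
/-- The closed neighbourhood of a set of vertices. -/
noncomputable def closedNbhd (G : SimpleGraph W) (S : Finset W) : Finset W :=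
  S ∪ S.biUnion fun x ↦ G.neighborFinset x

theorem mem_closedNbhd {G : SimpleGraph W} {S : Finset W} {y : W} :
    y ∈ closedNbhd G S ↔ y ∈ S ∨ ∃ x ∈ S, G.Adj x y := by
  simp [closedNbhd]

theorem mem_iterate_closedNbhd {G : SimpleGraph W} {r : ℕ} {S : Finset W} {y : W} :
    y ∈ (closedNbhd G)^[r] S ↔ ∃ x ∈ S, ∃ p : G.Walk x y, p.length ≤ r := by
  induction r generalizing S with
  | zero =>
    constructor
    · exact fun h ↦ ⟨y, h, .nil, le_rfl⟩
    · rintro ⟨x, hx, p, hp⟩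
      obtain rfl := p.eq_of_length_eq_zero (by omega)
      exact hx
  | succ r ih =>
    rw [Function.iterate_succ_apply, ih]
    constructor
    · rintro ⟨x, hx, p, hp⟩
      rcases mem_closedNbhd.1 hx with hx | ⟨z, hz, hzx⟩
      · exact ⟨x, hx, p, by omega⟩
      · exact ⟨z, hz, .cons hzx p, by simpa using hp⟩
    · rintro ⟨x, hx, p, hp⟩
      cases p with
      | nil => exact ⟨_, mem_closedNbhd.2 (Or.inl hx), .nil, by simp⟩
      | cons h p => exact ⟨_, mem_closedNbhd.2 (Or.inr ⟨x, hx, h⟩), p, by simpa using hp⟩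

-- Vertices gained in passing to the neighbourhood have degree at most Δ, and there are at most as
-- many of them as edge ends in S.
open Classical in
theorem sum_degree_closedNbhd_le {G : SimpleGraph W} {Δ : ℕ} {S : Finset W}
    (hS : ∀ x, Δ < G.degree x → x ∈ S) :
    ∑ x ∈ closedNbhd G S, G.degree x ≤ (1 + Δ) * ∑ x ∈ S, G.degree x := by
  set N := S.biUnion fun x ↦ G.neighborFinset x with hN
  have h1 : closedNbhd G S = S ∪ (N \ S) := by
    rw [Finset.union_sdiff_self_eq_union, closedNbhd]
  have h2 : (N \ S).card ≤ ∑ x ∈ S, G.degree x :=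
    (Finset.card_le_card Finset.sdiff_subset).trans
      (Finset.card_biUnion_le.trans_eq (by simp))
  rw [h1, Finset.sum_union Finset.disjoint_sdiff, add_mul, one_mul]
  refine Nat.add_le_add_left ?_ _
  calc ∑ x ∈ N \ S, G.degree x ≤ ∑ x ∈ N \ S, Δ := Finset.sum_le_sum fun x hx ↦ by
        by_contra h
        exact (Finset.mem_sdiff.1 hx).2 (hS x (by omega))
    _ = (N \ S).card * Δ := by rw [Finset.sum_const, smul_eq_mul]
    _ ≤ Δ * ∑ x ∈ S, G.degree x := by rw [mul_comm]; exact Nat.mul_le_mul_left _ h2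

open Classical in
theorem card_iterate_closedNbhd_le {G : SimpleGraph W} {Δ : ℕ} {x : W} {R : ℕ}
    (h : ∀ y ∈ (closedNbhd G)^[R] {x}, G.degree y ≤ Δ) :
    ∀ r ≤ R, ((closedNbhd G)^[r] {x}).card ≤ (1 + Δ) ^ r := by
  intro r hr
  induction r with
  | zero => simp
  | succ r ih =>
    rw [Function.iterate_succ_apply']
    set S := (closedNbhd G)^[r] {x} with hS
    have hd : ∀ y ∈ S, G.degree y ≤ Δ := by
      intro y hy
      refine h y ?_
      obtain ⟨z, hz, p, hp⟩ := mem_iterate_closedNbhd.1 hy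
      exact mem_iterate_closedNbhd.2 ⟨z, hz, p, by omega⟩
    have h1 : (S.biUnion fun x ↦ G.neighborFinset x).card ≤ S.card * Δ :=
      Finset.card_biUnion_le_card_mul _ _ _ (by simpa using hd)
    calc (closedNbhd G S).card ≤ S.card + S.card * Δ :=
          (Finset.card_union_le _ _).trans (Nat.add_le_add_left h1 _)
      _ = S.card * (1 + Δ) := by ring
      _ ≤ (1 + Δ) ^ r * (1 + Δ) := Nat.mul_le_mul_right _ (ih (by omega))
      _ = (1 + Δ) ^ (r + 1) := (pow_succ _ _).symm

open Classical in
/-- If every edge lies in many copies of `H`, then a positive proportion of the degree sum comes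
from the excess over `Δ`. -/
theorem sum_degree_le_mul_degreeExcess {H : SimpleGraph V} (hconn : H.Connected)
    {G : SimpleGraph W} {Δ : ℕ}
    (hA : ∀ x y, G.Adj x y →
      ((1 + Δ) ^ Fintype.card V) ^ Fintype.card V < labelledCopiesThrough H G s(x, y)) :
    ∑ x, G.degree x ≤ (1 + Δ) ^ (Fintype.card V + 1) * degreeExcess G Δ := by
  set v := Fintype.card V with hv
  set B : Finset W := Finset.univ.filter fun x ↦ Δ < G.degree x with hB
  have hB0 : ∑ x ∈ B, G.degree x ≤ (1 + Δ) * degreeExcess G Δ := by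
    rw [degreeExcess, Finset.mul_sum]
    refine (Finset.sum_le_sum (g := fun x ↦ (1 + Δ) * (G.degree x - Δ)) fun x hx ↦ ?_).trans
      (Finset.sum_le_sum_of_subset (Finset.subset_univ B))
    have : Δ < G.degree x := (Finset.mem_filter.1 hx).2
    obtain ⟨t, ht⟩ : ∃ t, G.degree x = Δ + 1 + t := ⟨_, (Nat.add_sub_of_le this).symm⟩
    rw [ht, show Δ + 1 + t - Δ = 1 + t by omega]
    nlinarith
  have hsub : ∀ r, ∀ x ∈ B, x ∈ (closedNbhd G)^[r] B := fun r x hx ↦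
    mem_iterate_closedNbhd.2 ⟨x, hx, .nil, by simp⟩
  have hBr : ∀ r, ∑ x ∈ (closedNbhd G)^[r] B, G.degree x ≤
      (1 + Δ) ^ (r + 1) * degreeExcess G Δ := by
    intro r
    induction r with
    | zero => simpa using hB0
    | succ r ih =>
      rw [Function.iterate_succ_apply']
      refine le_trans ?_ ((Nat.mul_le_mul_left (1 + Δ) ih).trans_eq (by ring))
      exact sum_degree_closedNbhd_le fun x hx ↦ hsub r x (by simpa [hB] using hx)
  -- Otherwise all degrees in the ball of radius v around x are at most Δ, so the ball has at most
  -- (1+Δ)^v vertices. As H is connected, every copy through an edge at x stays in the ball, and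
  -- there are too few such maps for `hA`.
  have hall : ∀ x, G.degree x ≠ 0 → x ∈ (closedNbhd G)^[v] B := by
    intro x hx
    by_contra hxB
    obtain ⟨y, hxy⟩ := (G.degree_pos_iff_exists_adj x).1 (Nat.pos_of_ne_zero hx)
    have hdeg : ∀ z ∈ (closedNbhd G)^[v] {x}, G.degree z ≤ Δ := by
      intro z hz
      by_contra hzd
      obtain ⟨x', hx', p, hp⟩ := mem_iterate_closedNbhd.1 hz
      obtain rfl := Finset.mem_singleton.1 hx'
      exact hxB (mem_iterate_closedNbhd.2 ⟨z, by simpa [hB] using hzd, p.reverse, by simpa using hp⟩)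
    have hball := card_iterate_closedNbhd_le (G := G) (Δ := Δ) (x := x) (R := v)
      hdeg v le_rfl
    refine absurd (hA x y hxy) (not_lt.2 ?_)
    rw [labelledCopiesThrough_eq_card]
    calc _ ≤ (Fintype.piFinset fun _ : V ↦ (closedNbhd G)^[v] {x}).card := by
          refine Finset.card_le_card fun φ hφ ↦ ?_
          rw [Finset.mem_filter, mem_copyMaps] at hφ
          obtain ⟨⟨-, hφ⟩, a, b, -, rfl, rfl⟩ := hφ
          rw [Fintype.mem_piFinset]
          intro w
          obtain ⟨p⟩ := hconn.preconnected a w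
          have hp := p.toPath.2.length_lt
          let f : H →g G := ⟨φ, fun {c d} h ↦ hφ c d h⟩
          exact mem_iterate_closedNbhd.2 ⟨φ a, by simp, (p.toPath.1.map f : G.Walk _ _),
            by rw [SimpleGraph.Walk.length_map]; exact hp.le⟩
      _ = ((closedNbhd G)^[v] {x}).card ^ v := by simp [hv]
      _ ≤ _ := Nat.pow_le_pow_left hball v
  refine le_trans (le_of_eq ?_) (hBr v)
  refine (Finset.sum_subset (Finset.subset_univ _) fun x _ hx ↦ ?_).symm
  by_contra h
  exact hx (hall x h)

end Excess

/-! ### Negligible families of copies -/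

section Counting

variable {V W : Type*} [Fintype V] [Fintype W]

open Classical in
theorem two_mul_card_edgeFinset_eq {H : SimpleGraph V} {Δ : ℕ} (hreg : H.IsRegularOfDegree Δ) :
    2 * H.edgeFinset.card = Fintype.card V * Δ := by
  rw [← SimpleGraph.sum_degrees_eq_twice_card_edges, Finset.sum_congr rfl fun v _ ↦ hreg v,
    Finset.sum_const, Finset.card_univ, smul_eq_mul]

/-- Shearer bounds the Δ-th power of a count by a multiple of (s^2)^e(H), which is (s^v)^Δ because
2e(H) = vΔ. -/
theorem le_mul_pow_of_pow_le {Δ v E : ℕ} (hΔ : 0 < Δ) (hE : 2 * E = v * Δ) {x s ζ C : ℝ}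
    (hs : 0 ≤ s) (hζ : 0 ≤ ζ) (h : x ^ Δ ≤ C * (s ^ 2) ^ E) (hC : C ≤ ζ ^ Δ) :
    x ≤ ζ * s ^ v := by
  refine le_of_pow_le_pow_left₀ hΔ.ne' (by positivity) (h.trans ?_)
  rw [mul_pow, ← pow_mul, ← pow_mul, hE]
  exact mul_le_mul_of_nonneg_right hC (by positivity)

open Classical in
/-- Few copies use an edge whose endpoints have a small product of degrees. -/
theorem card_copies_small_product_le {H : SimpleGraph V} {Δ : ℕ} (hΔ : 2 ≤ Δ)
    (hreg : H.IsRegularOfDegree Δ) (G : SimpleGraph W) {M c s ζ : ℝ} (hM : 1 ≤ M) (hc : 0 ≤ c)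
    (hc1 : c ≤ 1) (hs : 0 ≤ s) (hζ : 0 ≤ ζ) (hD : ((adjPairs G).card : ℝ) ≤ M * s ^ 2)
    (hcζ : ((adjPairs H).card : ℝ) ^ Δ * M ^ (H.edgeFinset.card + 1) * c ≤ ζ ^ Δ) :
    (((copyMaps H G).filter fun φ ↦ ∃ a b, H.Adj a b ∧
      ((G.degree (φ a) : ℝ) * G.degree (φ b)) < c * s ^ 2).card : ℝ) ≤ ζ * s ^ Fintype.card V := by
  refine le_mul_pow_of_pow_le (by omega) (two_mul_card_edgeFinset_eq hreg) hs hζ ?_ hcζ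
  set R := (adjPairs G).filter fun p ↦ ((G.degree p.1 : ℝ) * G.degree p.2) < c * s ^ 2 with hR
  set F : (V × V) × (W × W) → Finset (V → W) := fun q ↦
    (copyMaps H G).filter fun φ ↦ φ q.1.1 = q.2.1 ∧ φ q.1.2 = q.2.2 with hF
  set E := H.edgeFinset.card with hE
  by_cases hne : (adjPairs H) = ∅
  · have h0 : ((copyMaps H G).filter fun φ ↦ ∃ a b, H.Adj a b ∧
      ((G.degree (φ a) : ℝ) * G.degree (φ b)) < c * s ^ 2).card = 0 := by
      rw [Finset.card_eq_zero, Finset.filter_eq_empty_iff]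
      rintro φ - ⟨a, b, hab, -⟩
      have : (a, b) ∈ adjPairs H := by simpa [adjPairs] using hab
      simp [hne] at this
    rw [h0, Nat.cast_zero, zero_pow (by omega)]
    positivity
  obtain ⟨⟨a₀, b₀⟩, h₀⟩ := Finset.nonempty_iff_ne_empty.2 hne
  have h₀' : H.Adj a₀ b₀ := by simpa [adjPairs] using h₀
  obtain ⟨-, hr⟩ := card_edges_avoiding (by omega) hreg h₀'
  set r := (H.edgeFinset.filter fun e ↦ a₀ ∉ e ∧ b₀ ∉ e).card
  have h1 : ((copyMaps H G).filter fun φ ↦ ∃ a b, H.Adj a b ∧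
      ((G.degree (φ a) : ℝ) * G.degree (φ b)) < c * s ^ 2).card ≤
      ∑ q ∈ adjPairs H ×ˢ R, (F q).card := by
    refine le_trans (Finset.card_le_card ?_) Finset.card_biUnion_le
    intro φ hφ
    rw [Finset.mem_filter] at hφ
    obtain ⟨hφ, a, b, hab, hlt⟩ := hφ
    refine Finset.mem_biUnion.2 ⟨((a, b), (φ a, φ b)), ?_, ?_⟩
    · rw [Finset.mem_product]
      refine ⟨by simpa [adjPairs] using hab, ?_⟩
      rw [hR, Finset.mem_filter]
      exact ⟨by simpa [adjPairs] using (mem_copyMaps.1 hφ).2 a b hab, hlt⟩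
    · simp [hF, hφ]
  -- Each of the O(s^2) images of the distinguished edge extends in few ways. The powers of s^2 add
  -- up to Δ + (Δ-1) + r = e(H), and a factor c^(Δ-1) is gained.
  have h2 : ∀ q ∈ adjPairs H ×ˢ R,
      ((F q).card : ℝ) ^ Δ ≤ (c * s ^ 2) ^ (Δ - 1) * (M * s ^ 2) ^ r := by
    rintro ⟨⟨a, b⟩, x, y⟩ hq
    rw [Finset.mem_product, hR, Finset.mem_filter] at hq
    have hab : H.Adj a b := by simpa [adjPairs] using hq.1
    have h3 : ((F ((a, b), x, y)).card : ℝ) ^ Δ ≤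
        ((G.degree x : ℝ) * G.degree y) ^ (Δ - 1) * ((adjPairs G).card : ℝ) ^ r := by
      exact_mod_cast card_copies_fixed_edge_pow_le (by omega) hreg G hab x y hr
    refine h3.trans (mul_le_mul ?_ ?_ (by positivity) (by positivity))
    · exact pow_le_pow_left₀ (by positivity) hq.2.2.le _
    · exact pow_le_pow_left₀ (by positivity) hD _
  have hRle : (R.card : ℝ) ≤ M * s ^ 2 :=
    le_trans (by exact_mod_cast Finset.card_le_card (Finset.filter_subset _ _)) hD
  set A := adjPairs H ×ˢ R with hA
  have h4 : (∑ q ∈ A, ((F q).card : ℝ)) ^ Δ ≤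
      (A.card : ℝ) ^ Δ * ((c * s ^ 2) ^ (Δ - 1) * (M * s ^ 2) ^ r) := by
    have h5 := pow_sum_le_card_mul_sum_pow (s := A) (f := fun q ↦ ((F q).card : ℝ))
      (fun _ _ ↦ by positivity) (Δ - 1)
    rw [Nat.sub_add_cancel (by omega)] at h5
    refine h5.trans ((mul_le_mul_of_nonneg_left (Finset.sum_le_sum h2) (by positivity)).trans_eq ?_)
    rw [Finset.sum_const, nsmul_eq_mul, ← mul_assoc, ← pow_succ, Nat.sub_add_cancel (by omega)]
  calc _ ≤ (∑ q ∈ A, ((F q).card : ℝ)) ^ Δ := by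
        refine pow_le_pow_left₀ (by positivity) ?_ _
        exact_mod_cast h1
    _ ≤ (A.card : ℝ) ^ Δ * ((c * s ^ 2) ^ (Δ - 1) * (M * s ^ 2) ^ r) := h4
    _ ≤ (((adjPairs H).card : ℝ) * (M * s ^ 2)) ^ Δ * ((c * s ^ 2) ^ (Δ - 1) * (M * s ^ 2) ^ r) := by
        rw [hA, Finset.card_product, Nat.cast_mul]
        gcongr
    _ = ((adjPairs H).card : ℝ) ^ Δ * M ^ (Δ + r) * c ^ (Δ - 1) * (s ^ 2) ^ (r + (2 * Δ - 1)) := by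
        rw [show r + (2 * Δ - 1) = Δ + (Δ - 1) + r by omega]
        ring
    _ ≤ ((adjPairs H).card : ℝ) ^ Δ * M ^ (E + 1) * c * (s ^ 2) ^ E := by
        rw [hr]
        have hM' : M ^ (Δ + r) ≤ M ^ (E + 1) := pow_le_pow_right₀ hM (by omega)
        -- The gain is genuine because Δ ≥ 2.
        have hc' : c ^ (Δ - 1) ≤ c := by
          calc c ^ (Δ - 1) ≤ c ^ 1 := pow_le_pow_of_le_one hc hc1 (by omega)
            _ = c := pow_one c
        gcongr

open Classical in
/-- Copies using a prescribed edge in a small set of pairs. -/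
theorem card_copies_pair_mem_le {H : SimpleGraph V} {Δ : ℕ} (hΔ : 0 < Δ)
    (hreg : H.IsRegularOfDegree Δ) (G : SimpleGraph W) {M κ s ζ : ℝ} (hM : 1 ≤ M) (hκ : 0 ≤ κ)
    (hs : 0 ≤ s) (hζ : 0 ≤ ζ) (hD : ((adjPairs G).card : ℝ) ≤ M * s ^ 2)
    (hκζ : κ * M ^ H.edgeFinset.card ≤ ζ ^ Δ) (F : Finset (V → W)) (hF : F ⊆ copyMaps H G)
    {R : Finset (W × W)} (hR : (R.card : ℝ) ≤ κ * (M * s ^ 2)) {a b : V} (hab : H.Adj a b)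
    (hFR : ∀ φ ∈ F, (φ a, φ b) ∈ R) :
    (F.card : ℝ) ≤ ζ * s ^ Fintype.card V := by
  refine le_mul_pow_of_pow_le hΔ (two_mul_card_edgeFinset_eq hreg) hs hζ ?_ hκζ
  have h := card_pow_le_of_pair_mem hΔ hreg F (adjPairs G) R (fun φ hφ c d hcd ↦ by
    simpa [adjPairs] using (mem_copyMaps.1 (hF hφ)).2 c d hcd) hab hFR
  have hE : 0 < H.edgeFinset.card := Finset.card_pos.2 ⟨s(a, b), by simpa using hab⟩
  obtain ⟨E, hE'⟩ : ∃ E, H.edgeFinset.card = E + 1 := ⟨_, (Nat.sub_add_cancel hE).symm⟩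
  rw [hE'] at h ⊢
  calc ((F.card : ℝ)) ^ Δ ≤ R.card * ((adjPairs G).card : ℝ) ^ E := by exact_mod_cast h
    _ ≤ (κ * (M * s ^ 2)) * (M * s ^ 2) ^ E := by gcongr
    _ = _ := by ring

/-- With d = t + Δ this reads 2·d(d-1)⋯(d-Δ+1) ≤ (2d-Δ)^Δ. The factor 2 will pay for the two sides
of a bipartition; the inequality fails for Δ = 1. -/
theorem two_mul_descFactorial_le {Δ : ℕ} (hΔ : 2 ≤ Δ) (t : ℕ) :
    2 * (t + Δ).descFactorial Δ ≤ (2 * t + Δ) ^ Δ := by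
  induction Δ, hΔ using Nat.le_induction with
  | base =>
    simp only [Nat.descFactorial]
    have : t + 2 - 1 = t + 1 := by omega
    rw [this]
    simp
    nlinarith
  | succ n hn ih =>
    have h1 : (t + (n + 1)).descFactorial (n + 1) = (t + n + 1) * (t + n).descFactorial n := by
      rw [← add_assoc, Nat.succ_descFactorial_succ]
    rw [h1]
    have h2 : ((2 * t + n : ℕ) : ℝ) ^ n * (t + n + 1) ≤ ((2 * t + (n + 1) : ℕ) : ℝ) ^ (n + 1) := by
      have hpos : (0 : ℝ) < 2 * t + n := by
        have : (2 : ℝ) ≤ n := by exact_mod_cast hn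
        positivity
      -- Bernoulli's inequality for the ratio (2t+n+1)/(2t+n).
      have hb := one_add_mul_le_pow (a := 1 / (2 * t + n : ℝ)) (by
        have : (0 : ℝ) ≤ 1 / (2 * t + n : ℝ) := by positivity
        linarith) n
      have h3 : ((2 * t + (n + 1) : ℕ) : ℝ) = (2 * t + n) * (1 + 1 / (2 * t + n : ℝ)) := by
        push_cast
        field_simp
        ring
      have h4 : (t + n + 1 : ℝ) ≤ (1 + n * (1 / (2 * t + n : ℝ))) * ((2 * t + (n + 1) : ℕ) : ℝ) := by
        have h5 : (1 + n * (1 / (2 * t + n : ℝ))) * (2 * t + n) = 2 * t + 2 * n := by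
          field_simp
          ring
        have h6 : (0 : ℝ) ≤ 1 + n * (1 / (2 * t + n : ℝ)) := by positivity
        have h7 : (2 : ℝ) ≤ n := by exact_mod_cast hn
        have h8 : (0 : ℝ) ≤ t := by positivity
        push_cast
        nlinarith
      calc ((2 * t + n : ℕ) : ℝ) ^ n * (t + n + 1)
          ≤ ((2 * t + n : ℕ) : ℝ) ^ n *
            ((1 + 1 / (2 * t + n : ℝ)) ^ n * ((2 * t + (n + 1) : ℕ) : ℝ)) := by
            gcongr
            exact h4.trans (mul_le_mul_of_nonneg_right hb (by positivity))
        _ = ((2 * t + (n + 1) : ℕ) : ℝ) ^ (n + 1) := by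
            rw [pow_succ ((2 * t + (n + 1) : ℕ) : ℝ), ← mul_assoc, ← mul_pow]
            congr 2
            rw [h3]
            push_cast
            ring
    have h9 : (2 * t + n) ^ n * (t + n + 1) ≤ (2 * t + (n + 1)) ^ (n + 1) := by exact_mod_cast h2
    calc 2 * ((t + n + 1) * (t + n).descFactorial n)
        = (2 * (t + n).descFactorial n) * (t + n + 1) := by ring
      _ ≤ (2 * t + n) ^ n * (t + n + 1) := Nat.mul_le_mul_right _ ih
      _ ≤ _ := h9

end Counting

/-- In a connected graph, a nonempty set `I` that is not a side of a bipartition, and that contains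
no edge, is followed by an edge outside of `I`. -/
theorem exists_edge_outside {V : Type*} {H : SimpleGraph V} (hconn : H.Connected) {I : Finset V}
    (hne : I.Nonempty) (hind : ∀ a b, H.Adj a b → a ∈ I → b ∉ I)
    (hI : ¬∀ a b, H.Adj a b → (a ∈ I ↔ b ∉ I)) :
    ∃ i j r, H.Adj i j ∧ H.Adj j r ∧ i ∈ I ∧ j ∉ I ∧ r ∉ I := by
  by_contra! hcon
  obtain ⟨i₀, hi₀⟩ := hne
  -- If no such path exists, the neighbours of a neighbour of I lie in I, so by connectedness every
  -- vertex is in I or adjacent to it, and I is a side after all.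
  have hP : ∀ w, w ∈ I ∨ ∃ i ∈ I, H.Adj i w := by
    intro w
    obtain ⟨p⟩ := hconn.preconnected i₀ w
    have h0 : i₀ ∈ I ∨ ∃ i ∈ I, H.Adj i i₀ := Or.inl hi₀
    clear hi₀
    induction p with
    | nil => exact h0
    | @cons a b c hab p ih =>
      refine ih ?_
      rcases h0 with h0 | ⟨i, hi, hia⟩
      · exact Or.inr ⟨a, h0, hab⟩
      · exact Or.inl (hcon i a b hia hab hi (hind i a hia hi))
  refine hI fun a b hab ↦ ⟨hind a b hab, fun hb ↦ ?_⟩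
  by_contra ha
  obtain ⟨i, hi, hia⟩ := (hP a).resolve_left ha
  exact hb (hcon i a b hia hab hi ha)

/-! ### Copies whose low vertices form one side of a bipartition -/

section Bipartite

variable {V W : Type*} [Fintype V] [Fintype W]

open Classical in
/-- Copies of `H` that extend a given map on one side `I` of a bipartition. -/
theorem card_extensions_pow_le {H : SimpleGraph V} {Δ : ℕ} (hΔ : 0 < Δ)
    (hreg : H.IsRegularOfDegree Δ) {I : Finset V} (hI : ∀ a b, H.Adj a b → (a ∈ I ↔ b ∉ I))
    (G : SimpleGraph W) (P : W → Prop) (F : Finset (V → W)) (hF : F ⊆ copyMaps H G) (ξ : V → W)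
    (hξ : ∀ φ ∈ F, ∀ i ∈ I, φ i = ξ i) (hP : ∀ φ ∈ F, ∀ j ∉ I, P (φ j)) :
    F.card ^ Δ ≤ ∏ i ∈ I, ((G.neighborFinset (ξ i)).filter P).card.descFactorial Δ := by
  -- Shearer on the other side, covered Δ times by the neighbourhoods of the i in I. Injectivity on
  -- such a neighbourhood yields the falling factorial instead of a power.
  refine (card_pow_le_prod_card_image_restrict Iᶜ I (fun i ↦ H.neighborFinset i) hΔ ?_ F ξ ?_).trans
    (Finset.prod_le_prod' fun i hi ↦ ?_)
  · intro v hv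
    rw [← hreg v, ← SimpleGraph.card_neighborFinset_eq_degree]
    congr 1
    ext i
    simp only [Finset.mem_filter, SimpleGraph.mem_neighborFinset]
    constructor
    · exact fun h ↦ h.2.symm
    · exact fun h ↦ ⟨(hI i v h.symm).2 (Finset.mem_compl.1 hv), h.symm⟩
  · intro φ hφ v hv
    exact hξ φ hφ v (by simpa using hv)
  · set N := H.neighborFinset i
    set N' := (G.neighborFinset (ξ i)).filter P
    have hcard : Fintype.card (N ↪ N') = N'.card.descFactorial Δ := by
      rw [Fintype.card_embedding_eq, Fintype.card_coe, Fintype.card_coe,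
        SimpleGraph.card_neighborFinset_eq_degree, hreg i]
    rw [← hcard, ← Finset.card_univ]
    refine Finset.card_le_card_of_surjOn (fun (f : N ↪ N') v ↦ (f v : W)) ?_
    intro x hx
    obtain ⟨φ, hφ, rfl⟩ := Finset.mem_image.1 (Finset.mem_coe.1 hx)
    have hφ' := mem_copyMaps.1 (hF hφ)
    have hmem : ∀ v : N, φ v ∈ N' := by
      rintro ⟨v, hv⟩
      have hiv : H.Adj i v := by simpa [N] using hv
      rw [Finset.mem_filter, SimpleGraph.mem_neighborFinset, ← hξ φ hφ i hi]
      exact ⟨hφ'.2 i v hiv, hP φ hφ v ((hI i v hiv).1 hi)⟩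
    refine ⟨⟨fun v ↦ ⟨φ v, hmem v⟩, ?_⟩, by simp, rfl⟩
    intro v v' h
    exact Subtype.ext (hφ'.1 (by simpa using h))

-- Summing the Δ-th roots of the extension bounds over all maps on I factorises over the vertices of
-- I.
open Classical in
theorem card_bipartite_copies_le {H : SimpleGraph V} {Δ : ℕ} (hΔ : 0 < Δ)
    (hreg : H.IsRegularOfDegree Δ) {I : Finset V} (hI : ∀ a b, H.Adj a b → (a ∈ I ↔ b ∉ I))
    (G : SimpleGraph W) (P Q : W → Prop) (F : Finset (V → W)) (hF : F ⊆ copyMaps H G)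
    (hQ : ∀ φ ∈ F, ∀ i ∈ I, Q (φ i)) (hP : ∀ φ ∈ F, ∀ j ∉ I, P (φ j)) :
    (F.card : ℝ) ≤ (∑ x ∈ Finset.univ.filter Q,
      ((((G.neighborFinset x).filter P).card.descFactorial Δ : ℕ) : ℝ) ^ (1 / (Δ : ℝ))) ^ I.card := by
  rcases F.eq_empty_or_nonempty with rfl | ⟨φ₀, -⟩
  · simp only [Finset.card_empty, Nat.cast_zero]
    positivity
  set g : W → ℝ := fun x ↦
    ((((G.neighborFinset x).filter P).card.descFactorial Δ : ℕ) : ℝ) ^ (1 / (Δ : ℝ)) with hg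
  set t : V → Finset W := fun v ↦ if v ∈ I then Finset.univ.filter Q else {φ₀ v} with ht
  set res : (V → W) → V → W := fun φ v ↦ if v ∈ I then φ v else φ₀ v with hres
  have h1 : F.card = ∑ ξ ∈ Fintype.piFinset t, (F.filter fun φ ↦ res φ = ξ).card := by
    refine Finset.card_eq_sum_card_fiberwise fun φ hφ ↦ ?_
    rw [Finset.mem_coe, Fintype.mem_piFinset]
    intro v
    by_cases hv : v ∈ I
    · simpa [ht, hres, hv] using hQ φ hφ v hv
    · simp [ht, hres, hv]
  have h2 : ∀ ξ, ((F.filter fun φ ↦ res φ = ξ).card : ℝ) ≤ ∏ v, if v ∈ I then g (ξ v) else 1 := by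
    intro ξ
    have h3 := card_extensions_pow_le hΔ hreg hI G P (F.filter fun φ ↦ res φ = ξ)
      ((Finset.filter_subset _ _).trans hF) ξ (by
        intro φ hφ i hi
        rw [← (Finset.mem_filter.1 hφ).2]
        simp [hres, hi]) (fun φ hφ j hj ↦ hP φ (Finset.mem_filter.1 hφ).1 j hj)
    refine le_of_pow_le_pow_left₀ hΔ.ne' (Finset.prod_nonneg fun v _ ↦ by
      split_ifs <;> positivity) ?_
    have h4 : (∏ v, if v ∈ I then g (ξ v) else 1) ^ Δ =
        ∏ i ∈ I, (((G.neighborFinset (ξ i)).filter P).card.descFactorial Δ : ℝ) := by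
      rw [Finset.prod_ite_mem, Finset.univ_inter, ← Finset.prod_pow]
      refine Finset.prod_congr rfl fun i _ ↦ ?_
      rw [hg, one_div, Real.rpow_inv_natCast_pow (by positivity) hΔ.ne']
    rw [h4]
    exact_mod_cast h3
  calc (F.card : ℝ) = ∑ ξ ∈ Fintype.piFinset t, ((F.filter fun φ ↦ res φ = ξ).card : ℝ) := by
        exact_mod_cast h1
    _ ≤ ∑ ξ ∈ Fintype.piFinset t, ∏ v, if v ∈ I then g (ξ v) else 1 :=
        Finset.sum_le_sum fun ξ _ ↦ h2 ξ
    _ = ∏ v, ∑ x ∈ t v, if v ∈ I then g x else 1 :=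
        (Finset.prod_univ_sum t fun v x ↦ if v ∈ I then g x else 1).symm
    _ = ∏ v, if v ∈ I then ∑ x ∈ Finset.univ.filter Q, g x else 1 := by
        refine Finset.prod_congr rfl fun v _ ↦ ?_
        by_cases hv : v ∈ I <;> simp [ht, hv]
    _ = (∑ x ∈ Finset.univ.filter Q, g x) ^ I.card := by
        rw [Finset.prod_ite_mem, Finset.univ_inter, Finset.prod_const]

open Classical in
/-- A connected graph has at most two sides of bipartitions. -/
theorem card_bipartition_sides_le {H : SimpleGraph V} (hconn : H.Connected) :
    (Finset.univ.filter fun I : Finset V ↦ ∀ a b, H.Adj a b → (a ∈ I ↔ b ∉ I)).card ≤ 2 := by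
  obtain ⟨v₀⟩ := hconn.nonempty
  rw [← Fintype.card_bool, ← Finset.card_univ]
  refine Finset.card_le_card_of_injOn (fun I ↦ decide (v₀ ∈ I))
    (fun _ _ ↦ Finset.mem_coe.2 (Finset.mem_univ _)) ?_
  intro I hI I' hI' h
  simp only [Finset.coe_filter, Finset.mem_univ, true_and, Set.mem_ofPred_eq] at hI hI'
  have h0 : v₀ ∈ I ↔ v₀ ∈ I' := by simpa using h
  ext w
  obtain ⟨p⟩ := hconn.preconnected v₀ w
  induction p with
  | nil => exact h0
  | cons hadj p ih =>
    refine ih ?_ ?_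
    all_goals
      have h1 := hI _ _ hadj
      have h2 := hI' _ _ hadj
      simp only [decide_eq_decide] at h ⊢
      tauto

open Classical in
theorem bipartition_card {H : SimpleGraph V} {Δ : ℕ} (hΔ : 0 < Δ)
    (hreg : H.IsRegularOfDegree Δ) (hne : Nonempty V) {I : Finset V}
    (hI : ∀ a b, H.Adj a b → (a ∈ I ↔ b ∉ I)) : 2 * I.card = Fintype.card V ∧ Δ ≤ I.card := by
  have hb : H.IsBipartiteWith (I : Set V) ((Iᶜ : Finset V) : Set V) := by
    constructor
    · rw [Finset.disjoint_coe]
      exact disjoint_compl_right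
    · intro a b hab
      have := hI a b hab
      simp only [Finset.mem_coe, Finset.mem_compl]
      tauto
  have h1 := SimpleGraph.isBipartiteWith_sum_degrees_eq hb
  rw [Finset.sum_congr rfl fun v _ ↦ hreg v, Finset.sum_congr rfl fun v _ ↦ hreg v,
    Finset.sum_const, Finset.sum_const, smul_eq_mul, smul_eq_mul] at h1
  have h2 := Nat.eq_of_mul_eq_mul_right hΔ h1
  have h3 := Finset.card_add_card_compl I
  refine ⟨by omega, ?_⟩
  obtain ⟨v⟩ := hne
  have h4 : (H.neighborFinset v).card = Δ := hreg v
  rw [← h4]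
  by_cases hv : v ∈ I
  · rw [h2]
    exact Finset.card_le_card fun w hw ↦ Finset.mem_compl.2
      ((hI v w (by simpa using hw)).1 hv)
  · refine Finset.card_le_card fun w hw ↦ ?_
    by_contra hwI
    exact hv ((hI v w (by simpa using hw)).2 hwI)

end Bipartite

/-! ### The number of copies against the degree excess -/

section Main

variable {V W : Type*} [Fintype V] [Fintype W]

open Classical in
/-- The neighbours of `x` whose degree exceeds `K`. -/
noncomputable def highDegree (G : SimpleGraph W) (K : ℝ) (x : W) : ℕ :=
  ((G.neighborFinset x).filter fun y ↦ K < G.degree y).card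

/-- The contribution to the excess of a vertex with `d` neighbours of high degree. -/
def lowWeight (Δ d : ℕ) : ℕ := if Δ ≤ d then 2 * d - Δ else 0

theorem rpow_two_mul_descFactorial_le {Δ : ℕ} (hΔ : 2 ≤ Δ) (d : ℕ) :
    (2 : ℝ) ^ (1 / (Δ : ℝ)) * ((d.descFactorial Δ : ℕ) : ℝ) ^ (1 / (Δ : ℝ)) ≤ lowWeight Δ d := by
  rw [← Real.mul_rpow (by norm_num) (by positivity)]
  by_cases h : Δ ≤ d
  · obtain ⟨t, rfl⟩ : ∃ t, d = t + Δ := ⟨d - Δ, by omega⟩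
    rw [lowWeight, if_pos h, show 2 * (t + Δ) - Δ = 2 * t + Δ by omega]
    have h1 : (2 * ((t + Δ).descFactorial Δ : ℕ) : ℝ) ≤ ((2 * t + Δ : ℕ) : ℝ) ^ Δ := by
      exact_mod_cast two_mul_descFactorial_le hΔ t
    calc _ ≤ (((2 * t + Δ : ℕ) : ℝ) ^ Δ) ^ (1 / (Δ : ℝ)) :=
          Real.rpow_le_rpow (by positivity) h1 (by positivity)
      _ = _ := by rw [one_div, Real.pow_rpow_inv_natCast (by positivity) (by omega)]
  · rw [Nat.descFactorial_eq_zero_iff_lt.2 (by omega), lowWeight, if_neg h]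
    have : (Δ : ℝ) ≠ 0 := by positivity
    simp [this]

open Classical in
/-- The excess controls the edges between high vertices and the weights of the low vertices. -/
theorem high_add_low_le_degreeExcess (G : SimpleGraph W) {Δ : ℕ} {K K' ζ : ℝ} (hKK' : K ≤ K')
    (hζ : 0 ≤ ζ) (hK' : Δ * (1 + ζ) ≤ ζ * K') :
    (((adjPairs G).filter fun p ↦ K' < G.degree p.1 ∧ K' < G.degree p.2).card : ℝ) +
      ∑ x ∈ Finset.univ.filter (fun x ↦ (G.degree x : ℝ) ≤ K),
        (lowWeight Δ (highDegree G K' x) : ℝ) ≤ (1 + ζ) * degreeExcess G Δ := by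
  set Hi := Finset.univ.filter fun x ↦ K' < (G.degree x : ℝ) with hHi
  set Lo := Finset.univ.filter (fun x ↦ (G.degree x : ℝ) ≤ K) with hLo
  have hdis : Disjoint Hi Lo := by
    rw [Finset.disjoint_left]
    intro x hx hx'
    simp only [hHi, hLo, Finset.mem_filter, Finset.mem_univ, true_and] at hx hx'
    linarith
  have h1 : ∑ x ∈ Hi, (G.degree x - Δ) + ∑ x ∈ Lo, (G.degree x - Δ) ≤ degreeExcess G Δ := by
    rw [← Finset.sum_union hdis, degreeExcess]
    exact Finset.sum_le_sum_of_subset (Finset.subset_univ _)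
  -- Edge ends at high vertices, sorted by whether the other end is high or low.
  have h2 : ((adjPairs G).filter fun p ↦ K' < G.degree p.1 ∧ K' < G.degree p.2).card +
      ∑ x ∈ Lo, highDegree G K' x ≤ ∑ x ∈ Hi, G.degree x := by
    rw [hHi, ← card_adjPairs_filter_fst G (fun x ↦ K' < (G.degree x : ℝ))]
    have h3 : ∑ x ∈ Lo, highDegree G K' x =
        ((adjPairs G).filter fun p ↦ K' < G.degree p.1 ∧ (G.degree p.2 : ℝ) ≤ K).card := by
      rw [Finset.card_eq_sum_card_fiberwise (f := Prod.snd) (t := Lo)]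
      · refine Finset.sum_congr rfl fun x hx ↦ ?_
        rw [highDegree]
        simp only [hLo, Finset.mem_filter, Finset.mem_univ, true_and] at hx
        refine Finset.card_bij (fun y _ ↦ (y, x)) ?_ ?_ ?_
        · intro y hy
          simp only [Finset.mem_filter, SimpleGraph.mem_neighborFinset] at hy
          simp [adjPairs, hy.1.symm, hy.2, hx]
        · intro y _ y' _ h
          exact (Prod.ext_iff.1 h).1
        · rintro ⟨y, z⟩ hp
          simp only [adjPairs, Finset.mem_filter, Finset.mem_univ, true_and] at hp
          obtain ⟨⟨hyz, hy, -⟩, rfl⟩ := hp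
          exact ⟨y, by simp [hyz.symm, hy], rfl⟩
      · intro p hp
        simp only [Finset.coe_filter, Set.mem_ofPred_eq] at hp
        simpa [hLo] using hp.2.2
    rw [h3, ← Finset.card_union_of_disjoint]
    · refine Finset.card_le_card fun p hp ↦ ?_
      simp only [Finset.mem_union, Finset.mem_filter] at hp ⊢
      tauto
    · rw [Finset.disjoint_left]
      intro p hp hp'
      simp only [Finset.mem_filter] at hp hp'
      linarith [hp.2.2, hp'.2.2]
  -- A low x with d ≥ Δ high neighbours is counted d times at the high ends and has excess at least
  -- d - Δ itself: together 2d - Δ.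
  have h4 : ∑ x ∈ Lo, lowWeight Δ (highDegree G K' x) ≤
      ∑ x ∈ Lo, highDegree G K' x + ∑ x ∈ Lo, (G.degree x - Δ) := by
    rw [← Finset.sum_add_distrib]
    refine Finset.sum_le_sum fun x _ ↦ ?_
    have : highDegree G K' x ≤ G.degree x := Finset.card_filter_le _ _
    rw [lowWeight]
    split_ifs <;> omega
  have h5 : ∑ x ∈ Hi, (G.degree x : ℝ) ≤ (1 + ζ) * ∑ x ∈ Hi, ((G.degree x - Δ : ℕ) : ℝ) := by
    rw [Finset.mul_sum]
    refine Finset.sum_le_sum fun x hx ↦ ?_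
    simp only [hHi, Finset.mem_filter, Finset.mem_univ, true_and] at hx
    have h6 : (G.degree x : ℝ) - Δ ≤ ((G.degree x - Δ : ℕ) : ℝ) := by
      rw [sub_le_iff_le_add]
      exact_mod_cast (by omega : G.degree x ≤ G.degree x - Δ + Δ)
    have h7 : ζ * K' ≤ ζ * G.degree x := mul_le_mul_of_nonneg_left hx.le hζ
    nlinarith
  have h1' : ∑ x ∈ Hi, ((G.degree x - Δ : ℕ) : ℝ) + ∑ x ∈ Lo, ((G.degree x - Δ : ℕ) : ℝ) ≤
      degreeExcess G Δ := by exact_mod_cast h1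
  have h2' : (((adjPairs G).filter fun p ↦ K' < G.degree p.1 ∧ K' < G.degree p.2).card : ℝ) +
      ∑ x ∈ Lo, (highDegree G K' x : ℝ) ≤ ∑ x ∈ Hi, (G.degree x : ℝ) := by exact_mod_cast h2
  have h4' : ∑ x ∈ Lo, (lowWeight Δ (highDegree G K' x) : ℝ) ≤
      ∑ x ∈ Lo, (highDegree G K' x : ℝ) + ∑ x ∈ Lo, ((G.degree x - Δ : ℕ) : ℝ) := by
    exact_mod_cast h4
  have h8 : 0 ≤ ∑ x ∈ Lo, ((G.degree x - Δ : ℕ) : ℝ) := by positivity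
  nlinarith

open Classical in
/-- Few copies contain a path from a vertex of low degree through an edge with large product of
degrees, followed by a vertex of high degree. -/
theorem card_copies_low_path_le {H : SimpleGraph V} {Δ : ℕ} (hΔ0 : 0 < Δ)
    (hreg : H.IsRegularOfDegree Δ) (G : SimpleGraph W)
    {M κ c s ξ K K' : ℝ} (hM : 1 ≤ M) (hκ : 0 ≤ κ) (hc : 0 < c) (hs : 0 < s)
    (hξ : 0 ≤ ξ) (hK : 0 < K) (hKK' : K ≤ K') (hD : ((adjPairs G).card : ℝ) ≤ M * s ^ 2)
    (hκξ : κ * M ^ H.edgeFinset.card ≤ ξ ^ Δ) (hKM : M * K ≤ κ * c * K')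
    {i j r : V} (hjr : H.Adj j r) (F : Finset (V → W)) (hF : F ⊆ copyMaps H G)
    (hlow : ∀ φ ∈ F, c * s ^ 2 ≤ (G.degree (φ i) : ℝ) * G.degree (φ j) ∧
      (G.degree (φ i) : ℝ) ≤ K ∧ K' < (G.degree (φ r) : ℝ)) :
    (F.card : ℝ) ≤ ξ * s ^ Fintype.card V := by
  set VH := Finset.univ.filter fun x ↦ c * s ^ 2 ≤ K * (G.degree x : ℝ) with hVH
  set Hi := Finset.univ.filter fun x ↦ K' < (G.degree x : ℝ) with hHi
  have hsum : ∀ S : Finset W, ∑ x ∈ S, (G.degree x : ℝ) ≤ M * s ^ 2 := by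
    intro S
    refine le_trans ?_ hD
    rw [card_adjPairs]
    exact_mod_cast Finset.sum_le_sum_of_subset (Finset.subset_univ S)
  -- A partner of a low vertex has degree at least c s^2 / K, and only boundedly many vertices have
  -- that. So the edge jr has few possible images.
  have hVHc : (VH.card : ℝ) * c ≤ K * M := by
    have h1 : (VH.card : ℝ) * (c * s ^ 2) ≤ K * (M * s ^ 2) := by
      rw [← nsmul_eq_mul, ← Finset.sum_const]
      refine (Finset.sum_le_sum (g := fun x ↦ K * (G.degree x : ℝ)) fun x hx ↦ ?_).trans ?_
      · exact (Finset.mem_filter.1 hx).2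
      · rw [← Finset.mul_sum]
        exact mul_le_mul_of_nonneg_left (hsum _) hK.le
    have hs2 : 0 < s ^ 2 := by positivity
    nlinarith
  have hHic : (Hi.card : ℝ) * K' ≤ M * s ^ 2 := by
    rw [← nsmul_eq_mul, ← Finset.sum_const]
    exact (Finset.sum_le_sum fun x hx ↦ (Finset.mem_filter.1 hx).2.le).trans (hsum _)
  refine card_copies_pair_mem_le hΔ0 hreg G hM hκ hs.le hξ hD hκξ F
    hF (R := VH ×ˢ Hi) ?_ hjr ?_
  · rw [Finset.card_product, Nat.cast_mul]
    have hK'0 : 0 < K' := hK.trans_le hKK'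
    have h2 : ((VH.card : ℝ) * c) * (Hi.card * K') ≤ (K * M) * (M * s ^ 2) :=
      mul_le_mul hVHc hHic (by positivity) (by positivity)
    have h3 : (K * M) * (M * s ^ 2) ≤ (κ * c * K') * (M * s ^ 2) :=
      mul_le_mul_of_nonneg_right (by linarith) (by positivity)
    have h4 : ((VH.card : ℝ) * Hi.card) * (c * K') ≤ (κ * (M * s ^ 2)) * (c * K') := by
      linarith
    exact le_of_mul_le_mul_right h4 (by positivity)
  · intro φ hφ
    obtain ⟨h1, h2, h3⟩ := hlow φ hφ
    rw [Finset.mem_product]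
    refine ⟨?_, by simpa [hHi] using h3⟩
    simp only [hVH, Finset.mem_filter, Finset.mem_univ, true_and]
    exact h1.trans (mul_le_mul_of_nonneg_right h2 (by positivity))

set_option maxHeartbeats 1000000 in
open Classical in
/-- An upper bound for the number of copies of `H` in terms of the degree excess, for explicit
degree thresholds `K` and `K'`. -/
theorem card_copyMaps_le_of_thresholds {H : SimpleGraph V} (hconn : H.Connected) {Δ : ℕ}
    (hΔ : 2 ≤ Δ) (hreg : H.IsRegularOfDegree Δ) (G : SimpleGraph W)
    {M κ c s ζ ξ K K' : ℝ} (hM : 1 ≤ M) (hκ : 0 ≤ κ) (hc : 0 < c) (hc1 : c ≤ 1) (hs : 0 < s)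
    (hζ : 0 ≤ ζ) (hξ : 0 ≤ ξ) (hK : 0 < K) (hKK' : K ≤ K')
    (hD : ((adjPairs G).card : ℝ) ≤ M * s ^ 2)
    (hcξ : ((adjPairs H).card : ℝ) ^ Δ * M ^ (H.edgeFinset.card + 1) * c ≤ ξ ^ Δ)
    (hκξ : κ * M ^ H.edgeFinset.card ≤ ξ ^ Δ)
    (hKs : K ^ 2 < c * s ^ 2) (hKM : M * K ≤ κ * c * K') (hK' : Δ * (1 + ζ) ≤ ζ * K')
    (hmid : ∑ x ∈ Finset.univ.filter (fun x ↦ K < (G.degree x : ℝ) ∧ (G.degree x : ℝ) ≤ K'),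
      (G.degree x : ℝ) ≤ κ * (M * s ^ 2)) :
    ((copyMaps H G).card : ℝ) ≤
      ((1 + ζ) * degreeExcess G Δ) ^ ((Fintype.card V : ℝ) / 2) +
        (1 + Fintype.card V + 2 ^ Fintype.card V) * ξ * s ^ Fintype.card V := by
  have hΔ0 : 0 < Δ := by omega
  obtain ⟨v₀⟩ := hconn.nonempty
  have hnb : ∀ a, ∃ b, H.Adj a b := by
    intro a
    have : 0 < H.degree a := by rw [hreg a]; omega
    exact (H.degree_pos_iff_exists_adj a).1 this
  set v := Fintype.card V with hv
  set bad := (copyMaps H G).filter fun φ ↦ ∃ a b, H.Adj a b ∧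
      ((G.degree (φ a) : ℝ) * G.degree (φ b)) < c * s ^ 2 with hbad
  have hbadle : (bad.card : ℝ) ≤ ξ * s ^ v :=
    card_copies_small_product_le hΔ hreg G hM hc.le hc1 hs.le hξ hD hcξ
  set mid : V → Finset (V → W) := fun a ↦ (copyMaps H G).filter fun φ ↦
    K < (G.degree (φ a) : ℝ) ∧ (G.degree (φ a) : ℝ) ≤ K' with hmiddef
  have hmidle : ∀ a, ((mid a).card : ℝ) ≤ ξ * s ^ v := by
    intro a
    obtain ⟨b, hab⟩ := hnb a
    refine card_copies_pair_mem_le hΔ0 hreg G hM hκ hs.le hξ hD hκξ (mid a)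
      (Finset.filter_subset _ _) (R := (adjPairs G).filter fun p ↦
        K < (G.degree p.1 : ℝ) ∧ (G.degree p.1 : ℝ) ≤ K') ?_ hab ?_
    · refine le_trans (le_of_eq ?_) hmid
      rw [← Nat.cast_sum, Nat.cast_inj]
      convert card_adjPairs_filter_fst G (fun x ↦ K < (G.degree x : ℝ) ∧ (G.degree x : ℝ) ≤ K')
    · intro φ hφ
      rw [hmiddef, Finset.mem_filter] at hφ
      rw [Finset.mem_filter]
      exact ⟨by simpa [adjPairs] using (mem_copyMaps.1 hφ.1).2 a b hab, hφ.2⟩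
  set good : Finset V → Finset (V → W) := fun I ↦ (copyMaps H G).filter fun φ ↦
    (∀ a b, H.Adj a b → c * s ^ 2 ≤ (G.degree (φ a) : ℝ) * G.degree (φ b)) ∧
    (∀ a, a ∈ I → (G.degree (φ a) : ℝ) ≤ K) ∧ (∀ a, a ∉ I → K' < (G.degree (φ a) : ℝ)) with hgood
  have hgoodm : ∀ I, ∀ φ ∈ good I, φ ∈ copyMaps H G ∧
      (∀ a b, H.Adj a b → c * s ^ 2 ≤ (G.degree (φ a) : ℝ) * G.degree (φ b)) ∧
      (∀ a, a ∈ I → (G.degree (φ a) : ℝ) ≤ K) ∧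
      (∀ a, a ∉ I → K' < (G.degree (φ a) : ℝ)) := by
    intro I φ hφ
    rwa [hgood, Finset.mem_filter] at hφ
  -- A copy that is neither bad nor meets the middle degrees is sorted by its set I of low vertices.
  have hcover : copyMaps H G ⊆ bad ∪ Finset.univ.biUnion mid ∪ Finset.univ.biUnion good := by
    intro φ hφ
    by_cases h1 : φ ∈ bad
    · simp [h1]
    by_cases h2 : φ ∈ Finset.univ.biUnion mid
    · simp only [Finset.mem_union, h2, or_true, true_or]
    refine Finset.mem_union_right _ (Finset.mem_biUnion.2
      ⟨Finset.univ.filter fun a ↦ (G.degree (φ a) : ℝ) ≤ K, Finset.mem_univ _, ?_⟩)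
    rw [hgood, Finset.mem_filter]
    refine ⟨hφ, fun a b hab ↦ ?_, fun a ha ↦ by simpa using ha, fun a ha ↦ ?_⟩
    · by_contra hlt
      exact h1 (Finset.mem_filter.2 ⟨hφ, a, b, hab, not_le.1 hlt⟩)
    · by_contra hle
      refine h2 (Finset.mem_biUnion.2 ⟨a, Finset.mem_univ _, Finset.mem_filter.2 ⟨hφ, ?_⟩⟩)
      exact ⟨by simpa using ha, not_lt.1 hle⟩
  set Bip : Finset V → Prop := fun I ↦ ∀ a b, H.Adj a b → (a ∈ I ↔ b ∉ I) with hBip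
  -- Two adjacent low vertices would have degree product at most K^2 < c s^2.
  have hind : ∀ I, ∀ φ ∈ good I, ∀ a b, H.Adj a b → a ∈ I → b ∉ I := by
    intro I φ hφ a b hab ha hb
    obtain ⟨-, h1, h2, -⟩ := hgoodm I φ hφ
    have h3 := h1 a b hab
    have h4 : (G.degree (φ a) : ℝ) * G.degree (φ b) ≤ K * K :=
      mul_le_mul (h2 a ha) (h2 b hb) (by positivity) hK.le
    nlinarith
  have hmixed : ∀ I, I.Nonempty → ¬Bip I → ((good I).card : ℝ) ≤ ξ * s ^ v := by
    intro I hIne hIB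
    rcases (good I).eq_empty_or_nonempty with h0 | ⟨φ₀, hφ₀⟩
    · rw [h0, Finset.card_empty, Nat.cast_zero]
      exact mul_nonneg hξ (pow_nonneg hs.le _)
    obtain ⟨i, j, r, hij, hjr, hi, hj, hr⟩ :=
      exists_edge_outside hconn hIne (hind I φ₀ hφ₀) hIB
    refine card_copies_low_path_le (i := i) hΔ0 hreg G hM hκ hc hs hξ hK hKK' hD hκξ hKM hjr
      (good I) (Finset.filter_subset _ _) fun φ hφ ↦ ?_
    obtain ⟨-, h1, h2, h3⟩ := hgoodm I φ hφ
    exact ⟨h1 i j hij, h2 i hi, h3 r hr⟩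
  set hh := ((adjPairs G).filter fun p ↦ K' < (G.degree p.1 : ℝ) ∧ K' < (G.degree p.2 : ℝ)).card
    with hhh
  set Z := ∑ x ∈ Finset.univ.filter (fun x ↦ (G.degree x : ℝ) ≤ K),
        (lowWeight Δ (highDegree G K' x) : ℝ) with hZ
  have hZ0 : 0 ≤ Z := by positivity
  have hE := two_mul_card_edgeFinset_eq hreg
  have hhigh : ((good ∅).card : ℝ) ≤ (hh : ℝ) ^ ((v : ℝ) / 2) := by
    refine le_of_pow_le_pow_left₀ hΔ0.ne' (Real.rpow_nonneg (Nat.cast_nonneg _) _) ?_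
    rw [← Real.rpow_mul_natCast (Nat.cast_nonneg _), show (v : ℝ) / 2 * (Δ : ℝ) = H.edgeFinset.card by
      have : (2 : ℝ) * H.edgeFinset.card = v * Δ := by exact_mod_cast hE
      linarith, Real.rpow_natCast]
    have := card_pow_le_of_forall_pair_mem hΔ0 hreg (good ∅) ((adjPairs G).filter fun p ↦
      K' < (G.degree p.1 : ℝ) ∧ K' < (G.degree p.2 : ℝ)) (by
        intro φ hφ a b hab
        obtain ⟨h0, -, -, h3⟩ := hgoodm ∅ φ hφ
        rw [Finset.mem_filter]
        exact ⟨by simpa [adjPairs] using (mem_copyMaps.1 h0).2 a b hab,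
          h3 a (by simp), h3 b (by simp)⟩)
    exact_mod_cast this
  -- The factor 2 comes from (2^(1/Δ))^|I| ≥ 2, as |I| ≥ Δ; it makes up for there being two possible
  -- sides I.
  have hbip : ∀ I, Bip I → 2 * ((good I).card : ℝ) ≤ Z ^ ((v : ℝ) / 2) := by
    intro I hI
    obtain ⟨hc1, hc2⟩ := bipartition_card hΔ0 hreg ⟨v₀⟩ hI
    have h1 := card_bipartite_copies_le hΔ0 hreg hI G (fun y ↦ K' < (G.degree y : ℝ))
      (fun x ↦ (G.degree x : ℝ) ≤ K) (good I) (Finset.filter_subset _ _)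
      (fun φ hφ ↦ (hgoodm I φ hφ).2.2.1) (fun φ hφ ↦ (hgoodm I φ hφ).2.2.2)
    set Y := ∑ x ∈ Finset.univ.filter (fun x ↦ (G.degree x : ℝ) ≤ K),
      ((((G.neighborFinset x).filter fun y ↦ K' < (G.degree y : ℝ)).card.descFactorial Δ : ℕ) : ℝ)
        ^ (1 / (Δ : ℝ)) with hY
    have hY0 : 0 ≤ Y := Finset.sum_nonneg fun _ _ ↦ by positivity
    have h2 : (2 : ℝ) ^ (1 / (Δ : ℝ)) * Y ≤ Z := by
      rw [hY, hZ, Finset.mul_sum]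
      exact Finset.sum_le_sum fun x _ ↦ rpow_two_mul_descFactorial_le hΔ _
    have h3 : (2 : ℝ) ≤ ((2 : ℝ) ^ (1 / (Δ : ℝ))) ^ I.card := by
      calc (2 : ℝ) = ((2 : ℝ) ^ (1 / (Δ : ℝ))) ^ Δ := by
            rw [one_div, Real.rpow_inv_natCast_pow (by norm_num) hΔ0.ne']
        _ ≤ _ := pow_le_pow_right₀ (Real.one_le_rpow (by norm_num) (by positivity)) hc2
    have h4 : (v : ℝ) / 2 = (I.card : ℕ) := by
      rw [hv, ← hc1]
      push_cast
      ring
    rw [h4, Real.rpow_natCast]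
    calc 2 * ((good I).card : ℝ) ≤ ((2 : ℝ) ^ (1 / (Δ : ℝ))) ^ I.card * Y ^ I.card :=
          mul_le_mul h3 h1 (Nat.cast_nonneg _) (by positivity)
      _ = ((2 : ℝ) ^ (1 / (Δ : ℝ)) * Y) ^ I.card := (mul_pow _ _ _).symm
      _ ≤ Z ^ I.card := pow_le_pow_left₀ (mul_nonneg (by positivity) hY0) h2 _
  have hsumgood : ∑ I, ((good I).card : ℝ) ≤
      (hh : ℝ) ^ ((v : ℝ) / 2) + Z ^ ((v : ℝ) / 2) + 2 ^ v * (ξ * s ^ v) := by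
    have h1 : ∀ I, ((good I).card : ℝ) ≤ (if I = ∅ then (hh : ℝ) ^ ((v : ℝ) / 2) else 0) +
        (if Bip I then Z ^ ((v : ℝ) / 2) / 2 else 0) + ξ * s ^ v := by
      intro I
      have hp : 0 ≤ ξ * s ^ v := by positivity
      have hp' : 0 ≤ Z ^ ((v : ℝ) / 2) := Real.rpow_nonneg hZ0 _
      by_cases h0 : I = ∅
      · subst h0
        rw [if_pos rfl]
        split_ifs <;> linarith
      · rw [if_neg h0]
        by_cases hB : Bip I
        · rw [if_pos hB]
          linarith [hbip I hB]
        · rw [if_neg hB]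
          linarith [hmixed I (Finset.nonempty_iff_ne_empty.2 h0) hB]
    refine (Finset.sum_le_sum fun I _ ↦ h1 I).trans ?_
    rw [Finset.sum_add_distrib, Finset.sum_add_distrib, Finset.sum_ite_eq' Finset.univ ∅,
      if_pos (Finset.mem_univ _), ← Finset.sum_filter, Finset.sum_const, Finset.sum_const,
      Finset.card_univ, Fintype.card_finset, nsmul_eq_mul, nsmul_eq_mul]
    push_cast
    have h2 : ((Finset.univ.filter Bip).card : ℝ) ≤ 2 := by
      exact_mod_cast card_bipartition_sides_le hconn
    have h3 : ((Finset.univ.filter Bip).card : ℝ) * (Z ^ ((v : ℝ) / 2) / 2) ≤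
        2 * (Z ^ ((v : ℝ) / 2) / 2) := mul_le_mul_of_nonneg_right h2
      (div_nonneg (Real.rpow_nonneg hZ0 _) zero_le_two)
    linarith
  -- The power v/2 ≥ 1 is superadditive, which merges the two main terms.
  have hv2 : 1 ≤ (v : ℝ) / 2 := by
    have h1 : Δ < v := by rw [hv, ← hreg v₀]; exact H.degree_lt_card_verts v₀
    have h2 : (2 : ℝ) ≤ v := by exact_mod_cast (by omega : 2 ≤ v)
    linarith
  have hX := high_add_low_le_degreeExcess G hKK' hζ hK'
  calc ((copyMaps H G).card : ℝ) ≤ bad.card + ∑ a, ((mid a).card : ℝ) + ∑ I, ((good I).card : ℝ) := by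
        have := (Finset.card_le_card hcover).trans ((Finset.card_union_le _ _).trans
          (add_le_add ((Finset.card_union_le _ _).trans
            (add_le_add le_rfl Finset.card_biUnion_le)) Finset.card_biUnion_le))
        exact_mod_cast this
    _ ≤ ξ * s ^ v + v * (ξ * s ^ v) +
        ((hh : ℝ) ^ ((v : ℝ) / 2) + Z ^ ((v : ℝ) / 2) + 2 ^ v * (ξ * s ^ v)) := by
        refine add_le_add (add_le_add hbadle ?_) hsumgood
        refine (Finset.sum_le_sum fun a _ ↦ hmidle a).trans_eq ?_
        rw [Finset.sum_const, Finset.card_univ, nsmul_eq_mul]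
    _ ≤ ((hh : ℝ) + Z) ^ ((v : ℝ) / 2) + (1 + v + 2 ^ v) * ξ * s ^ v := by
        have := Real.add_rpow_le_rpow_add (Nat.cast_nonneg hh) hZ0 hv2
        linarith
    _ ≤ _ := add_le_add (Real.rpow_le_rpow (add_nonneg (Nat.cast_nonneg _) hZ0) hX
        (by linarith)) le_rfl

end Main

/-! ### Choice of the degree thresholds -/

section Thresholds

open Classical in
/-- Some multiplicative scale carries a small part of a sum. -/
theorem exists_scale_sum_le {W : Type*} [Fintype W] (d : W → ℝ) (hd : ∀ x, 0 ≤ d x) {S T K₀ : ℝ}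
    (hS : ∑ x, d x ≤ S) (hT : 1 ≤ T) (hK₀ : 0 < K₀) {J : ℕ} (hJ : 0 < J) :
    ∃ j < J, ∑ x ∈ Finset.univ.filter (fun x ↦ K₀ * T ^ j < d x ∧ d x ≤ K₀ * T ^ (j + 1)), d x ≤
      1 / J * S := by
  have hsum : ∑ j ∈ Finset.range J,
      ∑ x ∈ Finset.univ.filter (fun x ↦ K₀ * T ^ j < d x ∧ d x ≤ K₀ * T ^ (j + 1)), d x ≤
      ∑ _j ∈ Finset.range J, 1 / J * S := by
    have hR : ∑ _j ∈ Finset.range J, 1 / J * S = S := by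
      rw [Finset.sum_const, Finset.card_range, nsmul_eq_mul]
      field_simp
    rw [hR]
    refine le_trans ?_ hS
    simp_rw [Finset.sum_filter]
    rw [Finset.sum_comm]
    refine Finset.sum_le_sum fun x _ ↦ ?_
    rw [← Finset.sum_filter, Finset.sum_const, nsmul_eq_mul]
    -- The J windows are disjoint, so by pigeonhole one of them carries at most a fraction 1/J.
    have h1 : ((Finset.range J).filter
        fun j ↦ K₀ * T ^ j < d x ∧ d x ≤ K₀ * T ^ (j + 1)).card ≤ 1 := by
      have hlt : ∀ i j : ℕ, K₀ * T ^ j < d x → d x ≤ K₀ * T ^ (i + 1) → j ≤ i := by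
        intro i j hj hi
        by_contra hij
        have : K₀ * T ^ (i + 1) ≤ K₀ * T ^ j :=
          mul_le_mul_of_nonneg_left (pow_le_pow_right₀ hT (by omega)) hK₀.le
        linarith
      rw [Finset.card_le_one]
      intro i hi j hj
      rw [Finset.mem_filter] at hi hj
      exact le_antisymm (hlt j i hi.2.1 hj.2.2) (hlt i j hj.2.1 hi.2.2)
    calc _ ≤ 1 * d x := mul_le_mul_of_nonneg_right (by exact_mod_cast h1) (hd x)
      _ = d x := one_mul _
  obtain ⟨j, hj, h⟩ := Finset.exists_le_of_sum_le (Finset.nonempty_range_iff.2 hJ.ne') hsum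
  exact ⟨j, Finset.mem_range.1 hj, h⟩

open Classical in
/-- Asymptotically, the number of copies of `H` in a graph with `O(s ^ 2)` edges is at most the
power `v / 2` of the degree excess. -/
theorem card_copyMaps_le_rpow_degreeExcess {V : Type*} [Fintype V] {H : SimpleGraph V}
    (hconn : H.Connected) {Δ : ℕ} (hΔ : 2 ≤ Δ) (hreg : H.IsRegularOfDegree Δ)
    {M ζ : ℝ} (hM : 1 ≤ M) (hζ : 0 < ζ) :
    ∃ s₀ : ℝ, 0 < s₀ ∧ ∀ s, s₀ ≤ s → ∀ (n : ℕ) (G : SimpleGraph (Fin n)),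
      ((adjPairs G).card : ℝ) ≤ M * s ^ 2 →
      ((copyMaps H G).card : ℝ) ≤ ((1 + ζ) * degreeExcess G Δ) ^ ((Fintype.card V : ℝ) / 2) +
        ζ * s ^ Fintype.card V := by
  set v := Fintype.card V with hv
  set E := H.edgeFinset.card with hE
  set ξ := ζ / (1 + v + 2 ^ v) with hξ
  have hξ0 : 0 < ξ := by positivity
  set A := ((adjPairs H).card : ℝ) ^ Δ * M ^ (E + 1) with hA
  have hA0 : 0 ≤ A := mul_nonneg (pow_nonneg (Nat.cast_nonneg _) _) (by positivity)
  set c := min 1 (ξ ^ Δ / (1 + A)) with hc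
  have hc0 : 0 < c := lt_min one_pos (by positivity)
  have hc1 : c ≤ 1 := min_le_left _ _
  have hAc : A * c ≤ ξ ^ Δ := by
    calc A * c ≤ A * (ξ ^ Δ / (1 + A)) := mul_le_mul_of_nonneg_left (min_le_right _ _) hA0
      _ = (A / (1 + A)) * ξ ^ Δ := by ring
      _ ≤ 1 * ξ ^ Δ := by
        refine mul_le_mul_of_nonneg_right ?_ (by positivity)
        rw [div_le_one (by positivity)]
        linarith
      _ = ξ ^ Δ := one_mul _
  set κ := ξ ^ Δ / M ^ E with hκ
  have hκ0 : 0 < κ := by positivity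
  have hκM : κ * M ^ E ≤ ξ ^ Δ := by
    rw [hκ, div_mul_cancel₀]
    positivity
  obtain ⟨J, hJ⟩ := exists_nat_gt (1 / κ)
  have hJ0 : 0 < J := by
    have : (0 : ℝ) < J := lt_trans (by positivity) hJ
    exact_mod_cast this
  have hJκ : 1 / (J : ℝ) ≤ κ := by
    rw [one_div_le (by positivity) hκ0]
    exact hJ.le
  -- The ratio K'/K: large enough that copies mixing low and high vertices off a bipartition are
  -- few.
  set T := max 1 (M / (κ * c)) with hT
  have hT1 : 1 ≤ T := le_max_left _ _
  have hTM : M ≤ κ * c * T := by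
    have h1 : M / (κ * c) ≤ T := le_max_right _ _
    rw [div_le_iff₀ (by positivity)] at h1
    linarith
  set K₀ := max 1 (Δ * (1 + ζ) / ζ) with hK₀
  have hK₀1 : 1 ≤ K₀ := le_max_left _ _
  have hK₀Δ : Δ * (1 + ζ) ≤ ζ * K₀ := by
    have h1 : Δ * (1 + ζ) / ζ ≤ K₀ := le_max_right _ _
    rw [div_le_iff₀ hζ] at h1
    linarith
  have hK₀0 : 0 < K₀ := by linarith
  -- All candidate thresholds K are at most K₀ T^J, so this s₀ ensures K^2 < c s^2 whichever window
  -- is chosen.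
  refine ⟨K₀ * T ^ J / c + 1, by positivity, fun s hs n G hD ↦ ?_⟩
  have hs0 : 0 < s := lt_of_lt_of_le (by positivity) hs
  have hcs : (K₀ * T ^ J) ^ 2 < c * s ^ 2 := by
    have h1 : K₀ * T ^ J < c * s := by
      have : K₀ * T ^ J / c < s := by linarith
      rw [div_lt_iff₀ hc0] at this
      linarith
    calc (K₀ * T ^ J) ^ 2 < (c * s) ^ 2 := pow_lt_pow_left₀ h1 (by positivity) two_ne_zero
      _ = (c * s ^ 2) * c := by ring
      _ ≤ (c * s ^ 2) * 1 := mul_le_mul_of_nonneg_left hc1 (by positivity)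
      _ = c * s ^ 2 := mul_one _
  obtain ⟨j, hjJ, hmid⟩ := exists_scale_sum_le (fun x ↦ (G.degree x : ℝ)) (fun _ ↦ by positivity)
    (S := M * s ^ 2) (by
      rw [card_adjPairs] at hD
      exact_mod_cast hD) hT1 hK₀0 hJ0
  have hmain := card_copyMaps_le_of_thresholds hconn hΔ hreg G (M := M) (κ := κ) (c := c) (s := s)
    (ζ := ζ) (ξ := ξ) (K := K₀ * T ^ j) (K' := K₀ * T ^ (j + 1)) hM hκ0.le hc0 hc1 hs0 hζ.le hξ0.le
    (by positivity) (mul_le_mul_of_nonneg_left (pow_le_pow_right₀ hT1 (by omega)) hK₀0.le) hD hAc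
    hκM (lt_of_le_of_lt (pow_le_pow_left₀ (by positivity)
      (mul_le_mul_of_nonneg_left (pow_le_pow_right₀ hT1 hjJ.le) hK₀0.le) 2) hcs)
    (by
      calc M * (K₀ * T ^ j) ≤ (κ * c * T) * (K₀ * T ^ j) :=
            mul_le_mul_of_nonneg_right hTM (by positivity)
        _ = _ := by ring)
    (hK₀Δ.trans (mul_le_mul_of_nonneg_left (le_mul_of_one_le_right hK₀0.le
      (one_le_pow₀ hT1)) hζ.le))
    (hmid.trans (mul_le_mul_of_nonneg_right hJκ (by positivity)))
  refine hmain.trans_eq ?_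
  rw [hξ, ← hv]
  congr 2
  field_simp

end Thresholds

/-! ### Adjacent vertices of a core graph have a large product of degrees -/

section DegreeProduct

variable {V W : Type*} [Fintype V] [Fintype W]

open Classical in
/-- The number of copies through an edge is bounded in terms of the degrees of its endpoints. -/
theorem labelledCopiesThrough_pow_le {H : SimpleGraph V} {Δ : ℕ} (hΔ : 0 < Δ)
    (hreg : H.IsRegularOfDegree Δ) (G : SimpleGraph W) (x y : W) {r : ℕ}
    (hr : r + (2 * Δ - 1) = H.edgeFinset.card) :
    labelledCopiesThrough H G s(x, y) ^ Δ ≤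
      (adjPairs H).card ^ Δ * ((G.degree x * G.degree y) ^ (Δ - 1) * (adjPairs G).card ^ r) := by
  rw [labelledCopiesThrough_eq_card]
  set F : V × V → Finset (V → W) := fun q ↦ (copyMaps H G).filter fun φ ↦ φ q.1 = x ∧ φ q.2 = y
    with hF
  have h1 : ((copyMaps H G).filter fun φ ↦ ∃ a b, H.Adj a b ∧ φ a = x ∧ φ b = y).card ≤
      ∑ q ∈ adjPairs H, (F q).card := by
    refine le_trans (Finset.card_le_card fun φ hφ ↦ ?_) Finset.card_biUnion_le
    rw [Finset.mem_filter] at hφ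
    obtain ⟨hφ, a, b, hab, h⟩ := hφ
    refine Finset.mem_biUnion.2 ⟨(a, b), by simpa [adjPairs] using hab, ?_⟩
    rw [hF, Finset.mem_filter]
    exact ⟨hφ, h⟩
  refine (Nat.pow_le_pow_left h1 Δ).trans ?_
  have h5 := pow_sum_le_card_mul_sum_pow (s := adjPairs H) (f := fun q ↦ (F q).card)
    (fun _ _ ↦ Nat.zero_le _) (Δ - 1)
  rw [Nat.sub_add_cancel (by omega)] at h5
  refine h5.trans ((Nat.mul_le_mul_left _ (Finset.sum_le_sum fun q hq ↦
    card_copies_fixed_edge_pow_le hΔ hreg G (a := q.1) (b := q.2) (by simpa [adjPairs] using hq)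
      x y hr)).trans_eq ?_)
  rw [Finset.sum_const, smul_eq_mul, ← mul_assoc, Nat.cast_id, ← pow_succ,
    Nat.sub_add_cancel (by omega)]

open Classical in
/-- If every edge lies in `b * s ^ (v - 2) / L` copies and there are `O(s ^ 2 * L)` edges, then the
product of the degrees along any edge is at least `s ^ 2` up to a power of `L`. -/
theorem exists_degree_product_ge {H : SimpleGraph V} (hne : ∃ a b, H.Adj a b) {Δ : ℕ} (hΔ : 2 ≤ Δ)
    (hreg : H.IsRegularOfDegree Δ) {b C : ℝ} (hb : 0 < b) (hC : 0 < C) :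
    ∃ c > 0, ∃ q : ℕ, ∀ (n : ℕ) (G : SimpleGraph (Fin n)) (s L : ℝ), 0 < s → 1 ≤ L →
      ((adjPairs G).card : ℝ) ≤ C * (s ^ 2 * L) →
      ∀ x y, b * s ^ (Fintype.card V - 2) / L ≤ labelledCopiesThrough H G s(x, y) →
        c * s ^ 2 / L ^ q ≤ (G.degree x : ℝ) * G.degree y := by
  obtain ⟨a₀, b₀, h₀⟩ := hne
  obtain ⟨-, hr⟩ := card_edges_avoiding (by omega) hreg h₀
  set r := (H.edgeFinset.filter fun e ↦ a₀ ∉ e ∧ b₀ ∉ e).card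
  have hE := two_mul_card_edgeFinset_eq hreg
  set v := Fintype.card V with hv
  have hv2 : 2 ≤ v := by
    have h1 : Δ < v := by rw [hv, ← hreg a₀]; exact H.degree_lt_card_verts a₀
    omega
  have hexp : (v - 2) * Δ = 2 * r + 2 * (Δ - 1) := by
    rw [Nat.sub_mul]
    omega
  set A := ((adjPairs H).card : ℝ) ^ Δ with hA
  have hA0 : 0 ≤ A := pow_nonneg (Nat.cast_nonneg _) _
  set c₁ := b ^ Δ / ((1 + A) * C ^ r) with hc₁
  have hc₁0 : 0 < c₁ := by positivity
  -- The constant and the power of L are crude, which avoids extracting a root of order Δ-1.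
  refine ⟨min 1 c₁, lt_min one_pos hc₁0, Δ + r, fun n G s L hs hL hD x y hxy ↦ ?_⟩
  have hL0 : 0 < L := by linarith
  have h1 : (labelledCopiesThrough H G s(x, y) : ℝ) ^ Δ ≤
      A * (((G.degree x : ℝ) * G.degree y) ^ (Δ - 1) * ((adjPairs G).card : ℝ) ^ r) := by
    rw [hA]
    exact_mod_cast labelledCopiesThrough_pow_le (by omega) hreg G x y hr
  set P := (G.degree x : ℝ) * G.degree y with hP
  have hP0 : 0 ≤ P := by positivity
  have h2 : (b * s ^ (v - 2) / L) ^ Δ ≤ (1 + A) * (P ^ (Δ - 1) * (C * (s ^ 2 * L)) ^ r) := by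
    refine (pow_le_pow_left₀ (by positivity) hxy Δ).trans (h1.trans ?_)
    refine mul_le_mul (by linarith) (mul_le_mul_of_nonneg_left
      (pow_le_pow_left₀ (Nat.cast_nonneg _) hD r) (by positivity))
      (mul_nonneg (by positivity) (pow_nonneg (Nat.cast_nonneg _) _)) (by positivity)
  have h3 : c₁ * (s ^ 2) ^ (Δ - 1) / L ^ (Δ + r) ≤ P ^ (Δ - 1) := by
    have h4 : (b * s ^ (v - 2) / L) ^ Δ =
        (c₁ * (s ^ 2) ^ (Δ - 1) / L ^ (Δ + r)) * ((1 + A) * (C * (s ^ 2 * L)) ^ r) := by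
      rw [div_pow, mul_pow, ← pow_mul, hexp, hc₁, pow_add, pow_add, pow_mul, pow_mul, mul_pow C,
        mul_pow (s ^ 2) L]
      field_simp
    rw [h4] at h2
    have h5 : 0 < (1 + A) * (C * (s ^ 2 * L)) ^ r := by positivity
    refine le_of_mul_le_mul_right (h2.trans_eq (by ring)) h5
  have hΔ1 : Δ - 1 ≠ 0 := by omega
  refine le_of_pow_le_pow_left₀ hΔ1 hP0 (le_trans ?_ h3)
  have hm0 : 0 < min 1 c₁ := lt_min one_pos hc₁0
  rw [div_pow, mul_pow]
  have h6 : (min 1 c₁) ^ (Δ - 1) ≤ c₁ := by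
    calc (min 1 c₁) ^ (Δ - 1) ≤ (min 1 c₁) ^ 1 :=
          pow_le_pow_of_le_one hm0.le (min_le_left _ _) (by omega)
      _ ≤ c₁ := by rw [pow_one]; exact min_le_right _ _
  have h7 : L ^ (Δ + r) ≤ (L ^ (Δ + r)) ^ (Δ - 1) := by
    calc L ^ (Δ + r) = (L ^ (Δ + r)) ^ 1 := (pow_one _).symm
      _ ≤ _ := pow_le_pow_right₀ (one_le_pow₀ hL) (by omega)
  gcongr

end DegreeProduct

/-! ### Counting graphs by degree sequence -/

section GraphCount

open Classical in
/-- The number of graphs with given degrees, if adjacent vertices have a large product of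
degrees. -/
theorem card_graphs_le {n : ℕ} {θ B : ℝ} (hθ : 0 < θ) (hB : 0 ≤ B) (d : Fin n → ℕ)
    (S : Finset (SimpleGraph (Fin n))) (hdeg : ∀ G ∈ S, ∀ x, G.degree x = d x)
    (hprod : ∀ G ∈ S, ∀ x y, G.Adj x y → θ ≤ (d x : ℝ) * d y)
    (hsum : ∑ x, (d x : ℝ) ≤ B * θ) :
    (S.card : ℝ) ≤ ∏ x, (Real.exp 1 * B) ^ d x := by
  set Y : Fin n → Finset (Fin n) := fun x ↦ Finset.univ.filter fun y ↦ θ ≤ (d x : ℝ) * d y with hY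
  have hYc : ∀ x, ((Y x).card : ℝ) ≤ B * d x := by
    intro x
    have h1 : ((Y x).card : ℝ) * θ ≤ (B * d x) * θ := by
      calc ((Y x).card : ℝ) * θ = ∑ y ∈ Y x, θ := by rw [Finset.sum_const, nsmul_eq_mul]
        _ ≤ ∑ y ∈ Y x, (d x : ℝ) * d y := Finset.sum_le_sum fun y hy ↦ (Finset.mem_filter.1 hy).2
        _ ≤ ∑ y, (d x : ℝ) * d y :=
          Finset.sum_le_sum_of_subset_of_nonneg (Finset.subset_univ _) fun _ _ _ ↦ by positivity
        _ = d x * ∑ y, (d y : ℝ) := (Finset.mul_sum _ _ _).symm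
        _ ≤ d x * (B * θ) := mul_le_mul_of_nonneg_left hsum (by positivity)
        _ = _ := by ring
    exact le_of_mul_le_mul_right h1 hθ
  -- A graph is determined by its neighbourhoods, and that of x is a d_x-subset of Y x, which has at
  -- most B d_x elements.
  have h2 : S.card ≤ (Fintype.piFinset fun x ↦ (Y x).powersetCard (d x)).card := by
    refine Finset.card_le_card_of_injOn (fun G x ↦ G.neighborFinset x) ?_ ?_
    · intro G hG
      rw [Finset.mem_coe, Fintype.mem_piFinset]
      intro x
      rw [Finset.mem_powersetCard]
      refine ⟨fun y hy ↦ ?_, hdeg G hG x⟩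
      rw [hY, Finset.mem_filter]
      exact ⟨Finset.mem_univ _, hprod G hG x y (by simpa using hy)⟩
    · intro G _ G' _ h
      ext x y
      have := congrFun h x
      simp only at this
      rw [← SimpleGraph.mem_neighborFinset, this, SimpleGraph.mem_neighborFinset]
  refine (Nat.cast_le.2 h2).trans ?_
  rw [Fintype.card_piFinset, Nat.cast_prod]
  refine Finset.prod_le_prod (fun _ _ ↦ Nat.cast_nonneg _) fun x _ ↦ ?_
  rw [Finset.card_powersetCard]
  calc (((Y x).card.choose (d x) : ℕ) : ℝ) ≤ ((Y x).card : ℝ) ^ d x / (d x).factorial :=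
        Nat.choose_le_pow_div _ _
    _ ≤ (B * d x) ^ d x / (d x).factorial := by
        refine div_le_div_of_nonneg_right (pow_le_pow_left₀ (Nat.cast_nonneg _) (hYc x) _)
          (by positivity)
    _ = B ^ d x * ((d x : ℝ) ^ d x / (d x).factorial) := by rw [mul_pow, mul_div_assoc]
    _ ≤ B ^ d x * Real.exp (d x) :=
        mul_le_mul_of_nonneg_left (Real.pow_div_factorial_le_exp _ (by positivity) _)
          (by positivity)
    _ = (Real.exp 1 * B) ^ d x := by
        rw [mul_pow, ← Real.exp_nat_mul, mul_one, mul_comm]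

-- Grouping by degree sequence, the bound of `card_graphs_le` is a product over vertices, so the sum
-- over all sequences factorises.
open Classical in
theorem sum_graphs_prod_weight_le {n : ℕ} {θ B : ℝ} (hθ : 0 < θ) (hB : 0 ≤ B)
    (S : Finset (SimpleGraph (Fin n)))
    (hprod : ∀ G ∈ S, ∀ x y, G.Adj x y → θ ≤ (G.degree x : ℝ) * G.degree y)
    (hsum : ∀ G ∈ S, ∑ x, (G.degree x : ℝ) ≤ B * θ) (w : ℕ → ℝ) (hw : ∀ d, 0 ≤ w d) :
    ∑ G ∈ S, ∏ x, w (G.degree x) ≤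
      (∑ d ∈ Finset.range n, (Real.exp 1 * B) ^ d * w d) ^ n := by
  set t : Fin n → Finset ℕ := fun _ ↦ Finset.range n with ht
  have hmaps : ∀ G ∈ S, (fun x ↦ G.degree x) ∈ Fintype.piFinset t := by
    intro G _
    rw [Fintype.mem_piFinset]
    intro x
    simpa [ht] using G.degree_lt_card_verts x
  rw [← Finset.sum_fiberwise_of_maps_to hmaps]
  calc ∑ d ∈ Fintype.piFinset t, ∑ G ∈ S with (fun x ↦ G.degree x) = d, ∏ x, w (G.degree x)
      ≤ ∑ d ∈ Fintype.piFinset t, ∏ x, (Real.exp 1 * B) ^ d x * w (d x) := by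
        refine Finset.sum_le_sum fun d _ ↦ ?_
        rw [Finset.prod_mul_distrib]
        rcases (S.filter fun G ↦ (fun x ↦ G.degree x) = d).eq_empty_or_nonempty with h0 | ⟨G₀, hG₀⟩
        · rw [h0, Finset.sum_empty]
          exact mul_nonneg (Finset.prod_nonneg fun _ _ ↦ by positivity)
            (Finset.prod_nonneg fun _ _ ↦ hw _)
        · have hd : ∀ G ∈ S.filter (fun G ↦ (fun x ↦ G.degree x) = d), ∀ x, G.degree x = d x :=
            fun G hG x ↦ congrFun (Finset.mem_filter.1 hG).2 x
          rw [Finset.sum_congr rfl fun G hG ↦ Finset.prod_congr rfl fun x _ ↦ by rw [hd G hG x],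
            Finset.sum_const, nsmul_eq_mul]
          refine mul_le_mul_of_nonneg_right ?_ (Finset.prod_nonneg fun _ _ ↦ hw _)
          refine card_graphs_le hθ hB d _ hd ?_ ?_
          · intro G hG x y hxy
            rw [← hd G hG x, ← hd G hG y]
            exact hprod G (Finset.mem_filter.1 hG).1 x y hxy
          · have := hsum G₀ (Finset.mem_filter.1 hG₀).1
            simpa only [hd G₀ hG₀] using this
    _ = ∏ x, ∑ d ∈ t x, (Real.exp 1 * B) ^ d * w d :=
        (Finset.prod_univ_sum t fun _ d ↦ (Real.exp 1 * B) ^ d * w d).symm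
    _ = _ := by rw [ht, Finset.prod_const, Finset.card_univ, Fintype.card_fin]

end GraphCount

/-! ### The union bound in the random graph -/

open Classical in
/-- The probability that the binomial random graph contains a fixed graph. -/
theorem binomialRandom_setOf_le_le {V : Type*} [Fintype V] (p : unitInterval)
    (G : SimpleGraph V) :
    SimpleGraph.binomialRandom V p {ω | G ≤ ω} ≤
      ENNReal.ofReal ((p : ℝ) ^ G.edgeFinset.card) := by
  set a : NNReal := unitInterval.toNNReal p with ha
  set b : NNReal := unitInterval.toNNReal (unitInterval.symm p) with hb
  have hab : a + b = 1 := by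
    rw [← NNReal.coe_inj]
    simp [ha, hb]
  set E : Finset (Sym2 V) := (⊤ : SimpleGraph V).edgeFinset with hE
  have hEc : E.card = (Nat.card V).choose 2 := by
    rw [hE, SimpleGraph.card_edgeFinset_top_eq_card_choose_two, Nat.card_eq_fintype_card]
  set S : Finset (SimpleGraph V) := Finset.univ.filter fun ω ↦ G ≤ ω with hS
  have hsub : ∀ ω : SimpleGraph V, ω.edgeFinset ⊆ E := fun ω ↦
    SimpleGraph.edgeFinset_mono le_top
  have h1 : ∀ ω ∈ S, SimpleGraph.binomialRandom V p {ω} =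
      ((a ^ G.edgeFinset.card * (a ^ (ω.edgeFinset \ G.edgeFinset).card *
        b ^ ((E \ G.edgeFinset).card - (ω.edgeFinset \ G.edgeFinset).card)) : NNReal) : ENNReal) := by
    intro ω hω
    have hGω : G.edgeFinset ⊆ ω.edgeFinset :=
      SimpleGraph.edgeFinset_mono (Finset.mem_filter.1 hω).2
    rw [SimpleGraph.binomialRandom_singleton, ← hEc]
    have h2 : ω.edgeSet.ncard = ω.edgeFinset.card := by
      rw [← SimpleGraph.coe_edgeFinset, Set.ncard_coe_finset]
    rw [h2, Finset.card_sdiff_of_subset hGω, Finset.card_sdiff_of_subset (hsub G)]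
    have h3 := Finset.card_le_card hGω
    have h4 := Finset.card_le_card (hsub ω)
    rw [show E.card - G.edgeFinset.card - (ω.edgeFinset.card - G.edgeFinset.card) =
      E.card - ω.edgeFinset.card by omega, ← mul_assoc, ← pow_add,
      show G.edgeFinset.card + (ω.edgeFinset.card - G.edgeFinset.card) = ω.edgeFinset.card by omega]
    push_cast
    rfl
  -- The binomial theorem on the pairs outside G, with a + b = 1.
  have h2 : ∑ ω ∈ S, (a ^ (ω.edgeFinset \ G.edgeFinset).card *
        b ^ ((E \ G.edgeFinset).card - (ω.edgeFinset \ G.edgeFinset).card)) ≤ 1 := by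
    have h3 := Finset.sum_pow_mul_eq_add_pow a b (E \ G.edgeFinset)
    rw [hab, one_pow] at h3
    rw [← h3, ← Finset.sum_image (s := S) (g := fun ω ↦ ω.edgeFinset \ G.edgeFinset)
      (f := fun t ↦ a ^ t.card * b ^ ((E \ G.edgeFinset).card - t.card))]
    · refine Finset.sum_le_sum_of_subset fun t ht ↦ ?_
      obtain ⟨ω, -, rfl⟩ := Finset.mem_image.1 ht
      exact Finset.mem_powerset.2 (Finset.sdiff_subset_sdiff (hsub ω) le_rfl)
    · intro ω hω ω' hω' h
      have hGω : G.edgeFinset ⊆ ω.edgeFinset :=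
        SimpleGraph.edgeFinset_mono (Finset.mem_filter.1 hω).2
      have hGω' : G.edgeFinset ⊆ ω'.edgeFinset :=
        SimpleGraph.edgeFinset_mono (Finset.mem_filter.1 hω').2
      have : ω.edgeFinset = ω'.edgeFinset := by
        rw [← Finset.sdiff_union_of_subset hGω, ← Finset.sdiff_union_of_subset hGω']
        simp only at h
        rw [h]
      exact SimpleGraph.edgeFinset_inj.1 this
  have h3 : ({ω | G ≤ ω} : Set (SimpleGraph V)) = ⋃ ω ∈ S, {ω} := by
    ext ω
    simp [hS]
  rw [h3]
  refine (measure_biUnion_finset_le _ _).trans ?_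
  rw [Finset.sum_congr rfl h1, ← ENNReal.ofNNReal_finsetSum, ← Finset.mul_sum]
  have h4 : ENNReal.ofReal ((p : ℝ) ^ G.edgeFinset.card) = ((a ^ G.edgeFinset.card : NNReal) : ENNReal) := by
    rw [← ENNReal.ofReal_coe_nnreal]
    simp [ha]
  rw [h4, ENNReal.coe_le_coe]
  exact mul_le_of_le_one_right zero_le h2

open Classical in
/-- Union bound over the graphs of a finite family, given lower bounds for their degree excess. -/
theorem sum_pow_card_edgeFinset_le {n : ℕ} (hn : 0 < n) {Δ : ℕ} {p s a η θ B : ℝ} (hp : 0 < p)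
    (hp1 : p < 1) (hs : s = n * p ^ ((Δ : ℝ) / 2)) (hθ : 0 < θ) (hB : 0 ≤ B)
    (S : Finset (SimpleGraph (Fin n)))
    (hmin : ∀ G ∈ S, ∀ x, G.degree x ≠ 0 → Δ ≤ G.degree x)
    (hX : ∀ G ∈ S, a + η * ∑ x, (G.degree x : ℝ) ≤ degreeExcess G Δ)
    (hprod : ∀ G ∈ S, ∀ x y, G.Adj x y → θ ≤ (G.degree x : ℝ) * G.degree y)
    (hsum : ∀ G ∈ S, ∑ x, (G.degree x : ℝ) ≤ B * θ)
    (hsmall : Real.exp 1 * B * p ^ (η / 2) ≤ 1 / 2) :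
    ∑ G ∈ S, p ^ G.edgeFinset.card ≤ p ^ (a / 2) * Real.exp s := by
  have hn0 : (0 : ℝ) < n := by exact_mod_cast hn
  have hs0 : 0 < s := by rw [hs]; positivity
  -- Each non-isolated vertex carries s/n = p^(Δ/2) and its share p^(ηd/2) of the extra excess;
  -- isolated vertices cost nothing.
  set w : ℕ → ℝ := fun d ↦ (if d ≠ 0 then s / n else 1) * (p ^ (η / 2)) ^ d with hw
  have hw0 : ∀ d, 0 ≤ w d := fun d ↦ by
    simp only [hw]
    split_ifs <;> positivity
  have h1 : ∀ G ∈ S, p ^ G.edgeFinset.card ≤ p ^ (a / 2) * ∏ x, w (G.degree x) := by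
    intro G hG
    set k := (Finset.univ.filter fun x ↦ G.degree x ≠ 0).card with hk
    have h2 : ∏ x, w (G.degree x) = (s / n) ^ k * (p ^ (η / 2)) ^ (∑ x, G.degree x) := by
      simp only [hw]
      rw [Finset.prod_mul_distrib, Finset.prod_pow_eq_pow_sum, ← Finset.prod_filter,
        Finset.prod_const]
    have h3 : s / n = p ^ ((Δ : ℝ) / 2) := by
      rw [hs]
      field_simp
    have h4 := degreeExcess_add_mul (hmin G hG)
    have h4' : (degreeExcess G Δ : ℝ) + Δ * k = ∑ x, (G.degree x : ℝ) := by exact_mod_cast h4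
    have h5 : (∑ x, (G.degree x : ℝ)) = 2 * G.edgeFinset.card := by
      exact_mod_cast G.sum_degrees_eq_twice_card_edges
    have h6 := hX G hG
    rw [h2, h3, ← Real.rpow_mul_natCast hp.le, ← Real.rpow_mul_natCast hp.le, ← Real.rpow_add hp,
      ← Real.rpow_add hp, ← Real.rpow_natCast p]
    refine Real.rpow_le_rpow_of_exponent_ge hp hp1.le ?_
    push_cast
    linarith
  -- The term d = 0 is 1; the others are dominated by a geometric series of ratio 1/2 with sum at
  -- most s/n.
  have h7 : ∑ d ∈ Finset.range n, (Real.exp 1 * B) ^ d * w d ≤ 1 + s / n := by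
    obtain ⟨m, rfl⟩ : ∃ m, n = m + 1 := ⟨n - 1, by omega⟩
    rw [Finset.sum_range_succ']
    have h8 : (Real.exp 1 * B) ^ 0 * w 0 = 1 := by simp [hw]
    rw [h8, add_comm]
    refine add_le_add le_rfl ?_
    have h9 : ∀ d ∈ Finset.range m, (Real.exp 1 * B) ^ (d + 1) * w (d + 1) ≤
        s / (m + 1 : ℕ) * (1 / 2) * (1 / 2) ^ d := by
      intro d _
      simp only [hw, if_pos (Nat.succ_ne_zero d)]
      calc (Real.exp 1 * B) ^ (d + 1) * (s / (m + 1 : ℕ) * (p ^ (η / 2)) ^ (d + 1))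
          = s / (m + 1 : ℕ) * (Real.exp 1 * B * p ^ (η / 2)) ^ (d + 1) := by
            rw [mul_pow (Real.exp 1 * B)]
            ring
        _ ≤ s / (m + 1 : ℕ) * (1 / 2) ^ (d + 1) := by
            refine mul_le_mul_of_nonneg_left ?_ (by positivity)
            exact pow_le_pow_left₀ (by positivity) hsmall _
        _ = _ := by ring
    refine (Finset.sum_le_sum h9).trans ?_
    rw [← Finset.mul_sum]
    have h10 : ∑ d ∈ Finset.range m, (1 / 2 : ℝ) ^ d ≤ 2 := by
      have := sum_geometric_two_le m
      simpa using this
    have h11 : 0 ≤ s / (m + 1 : ℕ) := by positivity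
    nlinarith
  have h12 : 0 ≤ ∑ d ∈ Finset.range n, (Real.exp 1 * B) ^ d * w d :=
    Finset.sum_nonneg fun d _ ↦ mul_nonneg (by positivity) (hw0 d)
  calc ∑ G ∈ S, p ^ G.edgeFinset.card ≤ ∑ G ∈ S, p ^ (a / 2) * ∏ x, w (G.degree x) :=
        Finset.sum_le_sum h1
    _ = p ^ (a / 2) * ∑ G ∈ S, ∏ x, w (G.degree x) := (Finset.mul_sum _ _ _).symm
    _ ≤ p ^ (a / 2) * (∑ d ∈ Finset.range n, (Real.exp 1 * B) ^ d * w d) ^ n := by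
        refine mul_le_mul_of_nonneg_left ?_ (by positivity)
        exact sum_graphs_prod_weight_le hθ hB S hprod hsum w hw0
    _ ≤ p ^ (a / 2) * (Real.exp (s / n)) ^ n := by
        refine mul_le_mul_of_nonneg_left (pow_le_pow_left₀ h12 (h7.trans ?_) n) (by positivity)
        rw [add_comm]
        exact Real.add_one_le_exp _
    _ = p ^ (a / 2) * Real.exp s := by
        rw [← Real.exp_nat_mul, mul_div_cancel₀ _ hn0.ne']

/-! ### Structure of core graphs -/

section Core

variable {V : Type*} [Fintype V]

open Classical in
theorem le_degree_of_labelledCopiesThrough_pos {W : Type*} [Fintype W] {H : SimpleGraph V} {Δ : ℕ}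
    (hreg : H.IsRegularOfDegree Δ) {G : SimpleGraph W} {x y : W}
    (h : 0 < labelledCopiesThrough H G s(x, y)) : Δ ≤ G.degree x := by
  rw [labelledCopiesThrough_eq_card, Finset.card_pos] at h
  obtain ⟨φ, hφ⟩ := h
  rw [Finset.mem_filter, mem_copyMaps] at hφ
  obtain ⟨⟨hinj, hφ⟩, a, b, -, rfl, -⟩ := hφ
  rw [← hreg a, ← SimpleGraph.card_neighborFinset_eq_degree,
    ← SimpleGraph.card_neighborFinset_eq_degree]
  refine Finset.card_le_card_of_injOn φ ?_ hinj.injOn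
  intro c hc
  simpa using hφ a c (by simpa using hc)

/-- The lower bound on the degree excess `X` from an upper bound for the number of copies. -/
theorem excess_ge_of_power_bound {v : ℕ} (hv3 : 3 ≤ v) {δ ε κ₀ M ζ η s D X : ℝ}
    (hδ : 0 < δ) (hε : 0 < ε) (hε1 : ε < 1 / 8) (hκ₀0 : 0 < κ₀) (hM0 : 0 < M) (hζ0 : 0 < ζ)
    (hs0 : 0 < s) (hD0 : 0 ≤ D) (hX0 : 0 ≤ X) (hMκ : 2 * κ₀ * δ ^ (2 / (v : ℝ)) ≤ M)
    (hζ1 : ζ ≤ δ * ε / 4) (hζ2 : ζ ≤ ε / 8) (hη1 : η ≤ 1 / (2 * κ₀))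
    (hη2 : η ≤ δ ^ (2 / (v : ℝ)) * ε / (8 * M)) (hX1 : D ≤ κ₀ * X)
    (hcopies : D ≤ M * s ^ 2 →
      δ * (1 - 3 * ε) * s ^ v ≤ ((1 + ζ) * X) ^ ((v : ℝ) / 2) + ζ * s ^ v) :
    (1 - 7 / 2 * ε) * δ ^ (2 / (v : ℝ)) * s ^ 2 + η * D ≤ X := by
  have hv3' : (3 : ℝ) ≤ v := by exact_mod_cast hv3
  set τ := δ ^ (2 / (v : ℝ)) with hτ
  have hτ0 : 0 < τ := Real.rpow_pos_of_pos hδ _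
  -- With many edges, half of X ≥ D/κ₀ pays for τ s^2 and the other half for ηD. With few edges the
  -- copy count is used, and the coefficient of ε grows from 3 to 13/4 (error ζ s^v), 27/8 (factor
  -- 1+ζ) and 7/2 (term ηD).
  rcases le_total (M * s ^ 2) D with hcase | hcase
  · have h1 : 2 * κ₀ * τ * s ^ 2 ≤ D :=
      (mul_le_mul_of_nonneg_right hMκ (by positivity)).trans hcase
    have h2 : η * D ≤ 1 / (2 * κ₀) * D := mul_le_mul_of_nonneg_right hη1 hD0
    have h3 : τ * s ^ 2 ≤ 1 / (2 * κ₀) * D := by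
      rw [one_div_mul_eq_div, le_div_iff₀ (by positivity)]
      linarith
    have h4 : 1 / (2 * κ₀) * D + 1 / (2 * κ₀) * D ≤ X := by
      have : 1 / (2 * κ₀) * D + 1 / (2 * κ₀) * D = D / κ₀ := by
        field_simp
        ring
      rw [this, div_le_iff₀ hκ₀0]
      linarith
    have h5 : 0 ≤ ε * (τ * s ^ 2) := by positivity
    nlinarith
  · have h1 := hcopies hcase
    have hsvpos : 0 < s ^ v := by positivity
    have h3 : δ * (1 - 13 / 4 * ε) * s ^ v ≤ ((1 + ζ) * X) ^ ((v : ℝ) / 2) := by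
      have : ζ * s ^ v ≤ δ * ε / 4 * s ^ v := mul_le_mul_of_nonneg_right hζ1 hsvpos.le
      nlinarith
    have hpos : 0 < 1 - 13 / 4 * ε := by linarith
    have h4 : (δ * (1 - 13 / 4 * ε) * s ^ v) ^ (2 / (v : ℝ)) ≤ (1 + ζ) * X := by
      calc _ ≤ (((1 + ζ) * X) ^ ((v : ℝ) / 2)) ^ (2 / (v : ℝ)) :=
            Real.rpow_le_rpow (by positivity) h3 (by positivity)
        _ = (1 + ζ) * X := by
            rw [← Real.rpow_mul (by positivity), show (v : ℝ) / 2 * (2 / v) = 1 by field_simp,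
              Real.rpow_one]
    have h5 : τ * (1 - 13 / 4 * ε) * s ^ 2 ≤ (1 + ζ) * X := by
      refine le_trans ?_ h4
      rw [Real.mul_rpow (by positivity) (by positivity), Real.mul_rpow hδ.le hpos.le]
      have h6 : (s ^ v) ^ (2 / (v : ℝ)) = s ^ 2 := by
        rw [← Real.rpow_natCast s v, ← Real.rpow_mul hs0.le,
          show (v : ℝ) * (2 / v) = (2 : ℕ) by push_cast; field_simp, Real.rpow_natCast]
      rw [h6]
      -- Since 2/v ≤ 1, taking this root does not worsen the loss in ε.
      have h7 : 1 - 13 / 4 * ε ≤ (1 - 13 / 4 * ε) ^ (2 / (v : ℝ)) := by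
        calc 1 - 13 / 4 * ε = (1 - 13 / 4 * ε) ^ (1 : ℝ) := (Real.rpow_one _).symm
          _ ≤ _ := by
            refine Real.rpow_le_rpow_of_exponent_ge hpos (by linarith) ?_
            rw [div_le_one (by positivity)]
            linarith
      gcongr
    have h8 : η * D ≤ τ * ε / 8 * s ^ 2 := by
      calc η * D ≤ τ * ε / (8 * M) * (M * s ^ 2) :=
            mul_le_mul hη2 hcase hD0 (by positivity)
        _ = _ := by field_simp
    have h9 : τ * (1 - 27 / 8 * ε) * s ^ 2 ≤ X := by
      have h10 : (1 + ζ) * (τ * (1 - 27 / 8 * ε) * s ^ 2) ≤ (1 + ζ) * X := by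
        refine le_trans ?_ h5
        have h11 : (1 + ζ) * (1 - 27 / 8 * ε) ≤ 1 - 13 / 4 * ε := by nlinarith
        calc (1 + ζ) * (τ * (1 - 27 / 8 * ε) * s ^ 2)
            = ((1 + ζ) * (1 - 27 / 8 * ε)) * (τ * s ^ 2) := by ring
          _ ≤ (1 - 13 / 4 * ε) * (τ * s ^ 2) := mul_le_mul_of_nonneg_right h11 (by positivity)
          _ = _ := by ring
      exact le_of_mul_le_mul_left h10 (by positivity)
    linarith

open Classical in
/-- The structure of core graphs: many edges compared to vertices, and no edge between two vertices
of small degree. -/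
theorem exists_core_bounds {H : SimpleGraph V} (hconn : H.Connected) {Δ : ℕ} (hΔ : 2 ≤ Δ)
    (hreg : H.IsRegularOfDegree Δ) {δ ε C : ℝ} (hδ : 0 < δ) (hε : 0 < ε) (hε1 : ε < 1 / 8)
    (hC : 0 < C) :
    ∃ η > 0, ∃ c > 0, ∃ q : ℕ, ∃ A s₀ : ℝ, 0 < A ∧ 0 < s₀ ∧ ∀ (n : ℕ) (p s L : ℝ),
      s₀ ≤ s → 1 ≤ L → (n : ℝ) ^ 2 * p ^ Δ = s ^ 2 →
      (n : ℝ) ^ Fintype.card V * p ^ H.edgeSet.ncard = s ^ Fintype.card V →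
      Real.log (1 / p) = L → A * L ≤ s ^ (Fintype.card V - 2) →
      ∀ G : SimpleGraph (Fin n), IsCoreGraph H Δ δ ε C p G →
        (∀ x, G.degree x ≠ 0 → Δ ≤ G.degree x) ∧
        (1 - 7 / 2 * ε) * δ ^ (2 / (Fintype.card V : ℝ)) * s ^ 2 + η * ∑ x, (G.degree x : ℝ) ≤
          (degreeExcess G Δ : ℝ) ∧
        (∀ x y, G.Adj x y → c * s ^ 2 / L ^ q ≤ (G.degree x : ℝ) * G.degree y) ∧
        ∑ x, (G.degree x : ℝ) ≤ 2 * C * (s ^ 2 * L) := by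
  obtain ⟨v₀⟩ := hconn.nonempty
  obtain ⟨v₁, hv₁⟩ := (H.degree_pos_iff_exists_adj v₀).1 (by rw [hreg v₀]; omega)
  set v := Fintype.card V with hv
  have hv3 : 3 ≤ v := by
    have h1 : Δ < v := by rw [hv, ← hreg v₀]; exact H.degree_lt_card_verts v₀
    omega
  set τ := δ ^ (2 / (v : ℝ)) with hτ
  have hτ0 : 0 < τ := Real.rpow_pos_of_pos hδ _
  set b := δ * ε / C with hb
  have hb0 : 0 < b := by positivity
  obtain ⟨c, hc, q, hcq⟩ := exists_degree_product_ge ⟨v₀, v₁, hv₁⟩ hΔ hreg hb0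
    (by positivity : 0 < 2 * C)
  set κ₀ : ℝ := (1 + Δ) ^ (v + 1) with hκ₀
  have hκ₀0 : 0 < κ₀ := by positivity
  set M := max 1 (2 * κ₀ * τ) with hM
  have hM1 : 1 ≤ M := le_max_left _ _
  set ζ := min (δ * ε / 4) (ε / 8) with hζ
  have hζ0 : 0 < ζ := lt_min (by positivity) (by positivity)
  obtain ⟨s₀, hs₀, hcopies⟩ := card_copyMaps_le_rpow_degreeExcess hconn hΔ hreg hM1 hζ0
  set η := min (1 / (2 * κ₀)) (τ * ε / (8 * M)) with hη
  have hη0 : 0 < η := lt_min (by positivity) (by positivity)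
  set A₀ : ℕ := ((1 + Δ) ^ v) ^ v with hA₀
  -- This value of A makes b s^(v-2)/L at least A₀ + 1, so every edge lies in more than A₀ copies.
  refine ⟨η, hη0, c, hc, q, (A₀ + 1) / b, s₀, by positivity, hs₀, ?_⟩
  intro n p s L hs hL hs2 hsv hLp hAL G hG
  have hs0 : 0 < s := hs₀.trans_le hs
  have hL0 : 0 < L := by linarith
  have hD : ((adjPairs G).card : ℝ) = ∑ x, (G.degree x : ℝ) := by
    rw [card_adjPairs]
    push_cast
    rfl
  have hDE : ∑ x, (G.degree x : ℝ) = 2 * G.edgeSet.ncard := by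
    rw [← SimpleGraph.coe_edgeFinset, Set.ncard_coe_finset]
    exact_mod_cast G.sum_degrees_eq_twice_card_edges
  have hDle : ∑ x, (G.degree x : ℝ) ≤ 2 * C * (s ^ 2 * L) := by
    have h1 := hG.edges_le
    rw [hLp, mul_assoc C, hs2] at h1
    rw [hDE]
    linarith
  have hthrough : ∀ x y, G.Adj x y → b * s ^ (v - 2) / L ≤ labelledCopiesThrough H G s(x, y) := by
    intro x y hxy
    have h1 := hG.through_le s(x, y) hxy
    rw [hLp, mul_assoc C, hs2, hsv] at h1
    refine le_trans (le_of_eq ?_) h1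
    rw [hb, show s ^ v = s ^ (v - 2) * s ^ 2 by rw [← pow_add]; congr 1; omega]
    field_simp
  have hA : ∀ x y, G.Adj x y → A₀ < labelledCopiesThrough H G s(x, y) := by
    intro x y hxy
    have h1 : (A₀ : ℝ) + 1 ≤ b * s ^ (v - 2) / L := by
      rw [le_div_iff₀ hL0]
      rw [div_mul_eq_mul_div, div_le_iff₀ hb0] at hAL
      linarith
    have h2 : (A₀ : ℝ) < labelledCopiesThrough H G s(x, y) := by
      linarith [hthrough x y hxy]
    exact_mod_cast h2
  refine ⟨?_, ?_, ?_, hDle⟩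
  · intro x hx
    obtain ⟨y, hxy⟩ := (G.degree_pos_iff_exists_adj x).1 (Nat.pos_of_ne_zero hx)
    exact le_degree_of_labelledCopiesThrough_pos hreg (Nat.zero_lt_of_lt (hA x y hxy))
  · have hX1 : ∑ x, (G.degree x : ℝ) ≤ κ₀ * degreeExcess G Δ := by
      rw [hκ₀]
      exact_mod_cast sum_degree_le_mul_degreeExcess hconn hA
    set D := ∑ x, (G.degree x : ℝ) with hDdef
    set X : ℝ := (degreeExcess G Δ : ℝ) with hX
    have hD0 : 0 ≤ D := Finset.sum_nonneg fun _ _ ↦ Nat.cast_nonneg _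
    have hX0 : 0 ≤ X := Nat.cast_nonneg _
    refine excess_ge_of_power_bound hv3 hδ hε hε1 hκ₀0 (by positivity) hζ0 hs0 hD0 hX0
      (le_max_right _ _) (min_le_left _ _) (min_le_right _ _) (min_le_left _ _) (min_le_right _ _)
      hX1 fun hcase ↦ ?_
    have h2 := hG.copies_le
    rw [hsv, labelledCopyCount_eq_card_copyMaps] at h2
    exact h2.trans (hcopies s hs n G (by rw [hD]; exact hcase))
  · exact fun x y hxy ↦ hcq n G s L hs0 hL (by rw [hD]; exact hDle) x y (hthrough x y hxy)

end Core

/-! ### Asymptotic regime and conclusion -/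

/-- The asymptotics of `s = n p ^ (Δ / 2)` and `L = log (1 / p)` in the sparse localized regime. -/
theorem localized_regime_asymptotics {v Δ : ℕ} (hv : 3 ≤ v) (hΔ : 2 ≤ Δ) {p : ℕ → ℝ}
    (hp : ∀ n, 0 < p n ∧ p n < 1)
    (ho : (fun n : ℕ ↦ Real.log n ^ (1 / ((v : ℝ) - 2))) =o[atTop]
      fun n : ℕ ↦ (n : ℝ) * p n ^ ((Δ : ℝ) / 2))
    (hle : ∀ᶠ n : ℕ in atTop, (n : ℝ) * p n ^ ((Δ : ℝ) / 2) ≤ (n : ℝ) ^ (1 / 2 : ℝ)) :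
    Tendsto (fun n : ℕ ↦ (n : ℝ) * p n ^ ((Δ : ℝ) / 2)) atTop atTop ∧
    Tendsto (fun n : ℕ ↦ Real.log (1 / p n)) atTop atTop ∧
    ∀ A > 0, ∀ᶠ n : ℕ in atTop,
      A * Real.log (1 / p n) ≤ ((n : ℝ) * p n ^ ((Δ : ℝ) / 2)) ^ (v - 2) := by
  have hv2 : (0 : ℝ) < (v : ℝ) - 2 := by
    have : (3 : ℝ) ≤ v := by exact_mod_cast hv
    linarith
  have hΔ' : (2 : ℝ) ≤ Δ := by exact_mod_cast hΔ
  have hlog : Tendsto (fun n : ℕ ↦ Real.log n) atTop atTop :=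
    Real.tendsto_log_atTop.comp tendsto_natCast_atTop_atTop
  have hs0 : ∀ n : ℕ, 0 ≤ (n : ℝ) * p n ^ ((Δ : ℝ) / 2) := fun n ↦
    mul_nonneg (Nat.cast_nonneg _) (Real.rpow_nonneg (hp n).1.le _)
  have hbound : ∀ k > 0, ∀ᶠ n : ℕ in atTop,
      Real.log n ^ (1 / ((v : ℝ) - 2)) ≤ k * ((n : ℝ) * p n ^ ((Δ : ℝ) / 2)) := by
    intro k hk
    filter_upwards [ho.def hk, hlog.eventually_ge_atTop 0] with n hn hn0
    rwa [Real.norm_of_nonneg (Real.rpow_nonneg hn0 _), Real.norm_of_nonneg (hs0 n)] at hn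
  have hs : Tendsto (fun n : ℕ ↦ (n : ℝ) * p n ^ ((Δ : ℝ) / 2)) atTop atTop := by
    refine tendsto_atTop_mono' _ ?_ ((tendsto_rpow_atTop (by positivity)).comp hlog :
      Tendsto (fun n : ℕ ↦ Real.log n ^ (1 / ((v : ℝ) - 2))) atTop atTop)
    filter_upwards [hbound 1 one_pos] with n hn
    simpa using hn
  have hlogs : ∀ n : ℕ, 0 < n → Real.log ((n : ℝ) * p n ^ ((Δ : ℝ) / 2)) =
      Real.log n - (Δ : ℝ) / 2 * Real.log (1 / p n) := by
    intro n hn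
    rw [Real.log_mul (by positivity) (Real.rpow_pos_of_pos (hp n).1 _).ne',
      Real.log_rpow (hp n).1, one_div, Real.log_inv]
    ring
  refine ⟨hs, ?_, fun A hA ↦ ?_⟩
  -- As log s = log n - (Δ/2)L, the bound s ≤ n^(1/2) gives L ≥ (log n)/Δ; below, s ≥ 1 gives L ≤
  -- log n.
  · refine tendsto_atTop_mono' _ ?_ (hlog.const_mul_atTop (by positivity : 0 < 1 / (Δ : ℝ)))
    filter_upwards [hle, eventually_gt_atTop 0] with n hn hn0
    have h1 := Real.log_le_log (mul_pos (by positivity) (Real.rpow_pos_of_pos (hp n).1 _)) hn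
    rw [hlogs n hn0, Real.log_rpow (by positivity)] at h1
    rw [one_div_mul_eq_div, div_le_iff₀ (by positivity)]
    linarith
  · have hk : 0 < (1 / A) ^ (1 / ((v : ℝ) - 2)) := by positivity
    filter_upwards [hbound _ hk, eventually_gt_atTop 0, hs.eventually_ge_atTop 1,
      hlog.eventually_ge_atTop 0] with n hn hn0 hn1 hnl
    have h1 := Real.log_nonneg hn1
    rw [hlogs n hn0] at h1
    have hL0 : 0 ≤ Real.log (1 / p n) :=
      Real.log_nonneg (by rw [le_div_iff₀ (hp n).1]; linarith [(hp n).2])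
    have h2 : Real.log (1 / p n) ≤ Real.log n := by nlinarith
    have h3 : (Real.log n ^ (1 / ((v : ℝ) - 2))) ^ (v - 2) = Real.log n := by
      rw [show (v : ℝ) - 2 = ((v - 2 : ℕ) : ℝ) by rw [Nat.cast_sub (by omega)]; norm_num, one_div,
        Real.rpow_inv_natCast_pow hnl (by omega)]
    have h4 : ((1 / A) ^ (1 / ((v : ℝ) - 2))) ^ (v - 2) = 1 / A := by
      rw [show (v : ℝ) - 2 = ((v - 2 : ℕ) : ℝ) by rw [Nat.cast_sub (by omega)]; norm_num,
        one_div ((v - 2 : ℕ) : ℝ), Real.rpow_inv_natCast_pow (by positivity) (by omega)]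
    have h5 := pow_le_pow_left₀ (Real.rpow_nonneg hnl _) hn (v - 2)
    rw [h3, mul_pow, h4, one_div_mul_eq_div, le_div_iff₀ hA] at h5
    calc A * Real.log (1 / p n) ≤ A * Real.log n := mul_le_mul_of_nonneg_left h2 hA.le
      _ ≤ _ := by linarith

theorem ereal_le_neg_log_div {t r : ℝ} (hr : 0 < r) {P : ENNReal}
    (hP : P ≤ ENNReal.ofReal (Real.exp (-(t * r)))) :
    ((t : ℝ) : EReal) ≤ -ENNReal.log P / ((r : ℝ) : EReal) := by
  rw [EReal.le_div_iff_mul_le (by exact_mod_cast hr) (EReal.coe_ne_top r), EReal.le_neg]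
  refine (ENNReal.log_le_log hP).trans ?_
  rw [ENNReal.log_ofReal_of_pos (Real.exp_pos _), Real.log_exp]
  exact_mod_cast le_rfl

open Classical in
/-- For large `n`, the probability of containing a core graph is exponentially small. -/
theorem eventually_measure_largeCoreEvent_le {V : Type*} [Fintype V] {H : SimpleGraph V}
    (hconn : H.Connected) {Δ : ℕ} (hΔ : 2 ≤ Δ) (hreg : H.IsRegularOfDegree Δ) {δ ε C : ℝ}
    (Cstar : ℝ) (hδ : 0 < δ) (hε : 0 < ε) (hε1 : ε < 1 / 8) (hC : 0 < C) {p : ℕ → unitInterval}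
    (hp : ∀ n, 0 < (p n : ℝ) ∧ (p n : ℝ) < 1)
    (ho : (fun n : ℕ ↦ Real.log n ^ (1 / ((Fintype.card V : ℝ) - 2))) =o[atTop]
      fun n : ℕ ↦ (n : ℝ) * (p n : ℝ) ^ ((Δ : ℝ) / 2))
    (hle : ∀ᶠ n : ℕ in atTop,
      (n : ℝ) * (p n : ℝ) ^ ((Δ : ℝ) / 2) ≤ (n : ℝ) ^ (1 / 2 : ℝ)) :
    ∀ᶠ n : ℕ in atTop, 0 < (n : ℝ) ^ 2 * (p n : ℝ) ^ Δ * Real.log (1 / (p n : ℝ)) ∧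
      SimpleGraph.binomialRandom (Fin n) (p n) (largeCoreEvent H Δ δ ε C Cstar (p n) n) ≤
        ENNReal.ofReal (Real.exp (-(1 / 2 * δ ^ (2 / (Fintype.card V : ℝ)) * (1 - 4 * ε) *
          ((n : ℝ) ^ 2 * (p n : ℝ) ^ Δ * Real.log (1 / (p n : ℝ)))))) := by
  obtain ⟨v₀⟩ := hconn.nonempty
  obtain ⟨η, hη, c, hc, q, A, s₀, hA, hs₀, hcore⟩ :=
    exists_core_bounds hconn hΔ hreg hδ hε hε1 hC
  set v := Fintype.card V with hv
  have hv3 : 3 ≤ v := by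
    have h1 : Δ < v := by rw [hv, ← hreg v₀]; exact H.degree_lt_card_verts v₀
    omega
  have hE := two_mul_card_edgeFinset_eq hreg
  have hEn : H.edgeSet.ncard = H.edgeFinset.card := by
    rw [← SimpleGraph.coe_edgeFinset, Set.ncard_coe_finset]
  set τ := δ ^ (2 / (v : ℝ)) with hτ
  have hτ0 : 0 < τ := Real.rpow_pos_of_pos hδ _
  obtain ⟨hs, hL, hAL⟩ := localized_regime_asymptotics hv3 hΔ hp ho hle
  -- The factor p^(η/2) = e^(-ηL/2) beats the power L^(q+1) in B.
  have hdecay : Tendsto (fun L : ℝ ↦ Real.exp 1 * (2 * C / c) *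
      (L ^ ((q + 1 : ℕ) : ℝ) * Real.exp (-(η / 2) * L))) atTop (𝓝 0) := by
    have := (tendsto_rpow_mul_exp_neg_mul_atTop_nhds_zero ((q + 1 : ℕ) : ℝ) (η / 2)
      (by positivity)).const_mul (Real.exp 1 * (2 * C / c))
    rwa [mul_zero] at this
  filter_upwards [hs.eventually_ge_atTop s₀, hs.eventually_ge_atTop 1, hL.eventually_ge_atTop 1,
    hL.eventually_ge_atTop (4 / (ε * τ)), hAL A hA,
    (hL.eventually (hdecay.eventually_le_const (by norm_num : (0 : ℝ) < 1 / 2))),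
    eventually_gt_atTop 0] with n hsn hs1 hL1 hLτ hALn hsmall hn
  obtain ⟨hp0, hp1⟩ := hp n
  set s : ℝ := (n : ℝ) * (p n : ℝ) ^ ((Δ : ℝ) / 2) with hsdef
  set L : ℝ := Real.log (1 / (p n : ℝ)) with hLdef
  set P : ℝ := (p n : ℝ) with hP
  have hs0 : 0 < s := by linarith
  have hL0 : 0 < L := by linarith
  have hs2 : (n : ℝ) ^ 2 * P ^ Δ = s ^ 2 := by
    rw [hsdef, mul_pow, ← Real.rpow_mul_natCast hp0.le,
      show (Δ : ℝ) / 2 * (2 : ℕ) = (Δ : ℕ) by push_cast; ring, Real.rpow_natCast]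
  have hsv : (n : ℝ) ^ v * P ^ H.edgeSet.ncard = s ^ v := by
    rw [hsdef, mul_pow, ← Real.rpow_mul_natCast hp0.le, hEn,
      show (Δ : ℝ) / 2 * (v : ℕ) = (H.edgeFinset.card : ℕ) by
        have : (2 : ℝ) * H.edgeFinset.card = v * Δ := by exact_mod_cast hE
        linarith, Real.rpow_natCast]
  have hPL : P = Real.exp (-L) := by
    rw [hLdef, one_div, Real.log_inv, neg_neg, Real.exp_log hp0]
  set S : Finset (SimpleGraph (Fin n)) := Finset.univ.filter fun G ↦ IsCoreGraph H Δ δ ε C P G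
    with hS
  have hcoreS : ∀ G ∈ S, _ := fun G hG ↦
    hcore n P s L hsn hL1 hs2 hsv rfl hALn G (Finset.mem_filter.1 hG).2
  have hθ : 0 < c * s ^ 2 / L ^ q := by positivity
  have hBθ : 2 * C * (s ^ 2 * L) = (2 * C / c * L ^ (q + 1)) * (c * s ^ 2 / L ^ q) := by
    field_simp
    ring
  have hunion := sum_pow_card_edgeFinset_le hn hp0 hp1 hsdef hθ
    (by positivity : 0 ≤ 2 * C / c * L ^ (q + 1)) S (fun G hG ↦ (hcoreS G hG).1)
    (fun G hG ↦ (hcoreS G hG).2.1) (fun G hG ↦ (hcoreS G hG).2.2.1)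
    (fun G hG ↦ (hcoreS G hG).2.2.2.trans_eq hBθ) (by
      refine le_trans (le_of_eq ?_) hsmall
      rw [hPL, ← Real.exp_mul, Real.rpow_natCast, show -L * (η / 2) = -(η / 2) * L by ring]
      ring)
  refine ⟨by rw [hs2]; positivity, ?_⟩
  have hsub : largeCoreEvent H Δ δ ε C Cstar P n ⊆ ⋃ G ∈ S, {ω | G ≤ ω} := by
    rintro ω ⟨G, hGω, hG, -⟩
    simp only [Set.mem_iUnion]
    exact ⟨G, by simpa [hS] using hG, hGω⟩
  refine (measure_mono hsub).trans ((measure_biUnion_finset_le _ _).trans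
    ((Finset.sum_le_sum fun G _ ↦ binomialRandom_setOf_le_le (p n) G).trans ?_))
  rw [← ENNReal.ofReal_sum_of_nonneg fun G _ ↦ pow_nonneg hp0.le _]
  refine ENNReal.ofReal_le_ofReal (hunion.trans ?_)
  rw [hPL, ← Real.exp_mul, ← Real.exp_add, ← hPL, hs2]
  refine Real.exp_le_exp.2 ?_
  -- The factor e^s is absorbed because s ≤ ετ s^2 L/4, which turns 7/2 into 4.
  have h1 : s * 4 ≤ s * (L * (ε * τ)) := by
    refine mul_le_mul_of_nonneg_left ?_ hs0.le
    rwa [div_le_iff₀ (by positivity)] at hLτ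
  have h2 : s * (L * (ε * τ)) ≤ s * (s * (L * (ε * τ))) :=
    mul_le_mul_of_nonneg_left (le_mul_of_one_le_left (by positivity) hs1) hs0.le
  nlinarith

theorem propositionp {V : Type*} [Fintype V] (H : SimpleGraph V) [DecidableRel H.Adj] (Δ : ℕ)
    (hΔ : 2 ≤ Δ) (hreg : H.IsRegularOfDegree Δ) (hconn : H.Connected) :
    ∃ f : ℝ → ℝ, (∀ ε, 0 ≤ f ε) ∧ Tendsto f (𝓝[>] 0) (𝓝 0) ∧
      ∃ ε₀ : ℝ, 0 < ε₀ ∧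
        ∀ δ : ℝ, 0 < δ → ∀ ε : ℝ, 0 < ε → ε < ε₀ → ∀ Cbar : ℝ, 0 < Cbar →
        ∀ Cstar : ℝ, 32 * δ ^ (2 / (Fintype.card V : ℝ)) ≤ Cstar →
        ∀ p : ℕ → unitInterval, (∀ n, 0 < (p n : ℝ) ∧ (p n : ℝ) < 1) →
          ((fun n : ℕ ↦ Real.log n ^ (1 / ((Fintype.card V : ℝ) - 2))) =o[atTop]
            fun n : ℕ ↦ (n : ℝ) * (p n : ℝ) ^ ((Δ : ℝ) / 2)) →
          (∀ᶠ n : ℕ in atTop,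
            (n : ℝ) * (p n : ℝ) ^ ((Δ : ℝ) / 2) ≤ (n : ℝ) ^ (1 / 2 : ℝ)) →
          ((1 / 2 * δ ^ (2 / (Fintype.card V : ℝ)) * (1 - f ε) : ℝ) : EReal) ≤
            liminf (fun n : ℕ ↦
              -ENNReal.log (SimpleGraph.binomialRandom (Fin n) (p n)
                  (largeCoreEvent H Δ δ ε Cbar Cstar (p n) n)) /
                (((n : ℝ) ^ 2 * (p n : ℝ) ^ Δ * Real.log (1 / (p n : ℝ)) : ℝ) : EReal)) atTop := by
  refine ⟨fun ε ↦ 4 * |ε|, fun ε ↦ by positivity, ?_, 1 / 8, by norm_num, ?_⟩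
  · have h : Tendsto (fun ε : ℝ ↦ 4 * |ε|) (𝓝 0) (𝓝 (4 * |0|)) :=
      (continuous_const.mul continuous_abs).tendsto 0
    rw [abs_zero, mul_zero] at h
    exact h.mono_left nhdsWithin_le_nhds
  · intro δ hδ ε hε hε1 Cbar hC Cstar _ p hp ho hle
    refine le_liminf_of_le (by isBoundedDefault) ?_
    filter_upwards [eventually_measure_largeCoreEvent_le hconn hΔ (fun v ↦ by convert hreg v)
      Cstar hδ hε hε1 hC hp ho hle] with n hn
    rw [abs_of_pos hε]
    exact ereal_le_neg_log_div hn.1 hn.2
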